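/- **Setting.** Let $X_0\subset\mathbb R^n$ be nonempty, closed and convex, $\mathcal O_0\supseteq X_0$ open and convex, and $\xi$ a random vector whose distribution $P$ is supported on $\Xi\subseteq\mathbb R^q$. Let $F:\mathcal O_0\times\Xi\to\mathbb R$ and $G=(G_1,\dots,G_p):\mathcal O_0\times\Xi\to\mathbb R^p$ be differentiable in $x$ and $P$-integrable in $\xi$, and put $f(x)=\mathbb E[F(x,\xi)]$, $g_i(x)=\mathbb E[G_i(x,\xi)]$, $g=(g_1,\dots,g_p)$. The problem is to minimize $f(x)$ over $x\in X_0$ subject to $g_i(x)\le 0$, $i=1,\dots,p$. All vector norms are Euclidean, and $[a]_+=\max\{a,0\}$. **Assumptions.** There are positive constants $D_0,\nu_g,\kappa_f,\kappa_g,\kappa_\Sigma,\epsilon_0,L_0,L_1,\dots,L_p,\rho_c$ such that, for all $i=1,\dots,p$: - $\|x-z\|\le D_0$ for all $x,z\in X_0$; - $\|G(x,\xi)\|\le\nu_g$, $\|\nabla_xF(x,\xi)\|\le\kappa_f$ and $\|\nabla_xG_i(x,\xi)\|\le\kappa_g$ for all $(x,\xi)\in\mathcal O_0\times\Xi$; -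 there is $\widehat x\in X_0$ with $g_i(\widehat x)\le-\epsilon_0$ for all $i$; - for every $\xi\in\Xi$ the functions $F(\cdot,\xi)+\frac{L_0}{2}\|\cdot\|^2$ and $G_i(\cdot,\xi)+\frac{L_i}{2}\|\cdot\|^2$ are convex on $\mathcal O_0$; - $\sqrt p\,\kappa_\Sigma D_0^2\le\epsilon_0$; - (Assumption C) $\mathbb E\big[\exp\{(G_i(x,\xi)-g_i(x))^2/\rho_c^2\}\big]\le e$ for all $x\in X_0$. **Constants.** Put $$\gamma_1=\nu_g+\sqrt p\,\big(\kappa_gD_0+\tfrac12\kappa_\Sigma D_0^2\big),\qquad \gamma_2=\nu_g+\kappa_gD_0+\tfrac12\kappa_\Sigma D_0^2,\qquad \beta=2\Big[L_0+\sum_{j=1}^p\gamma_2L_j\Big]+1,$$ $$\kappa_0=\frac{4\kappa_fD_0}{\epsilon_0},\quad \kappa_1=\frac{2D_0^2}{\epsilon_0},\quad \kappa_3=\frac{2\nu_g^2}{\epsilon_0}-\gamma_1,\quad \kappa_4=2\gamma_1+\frac{\epsilon_0}{4}+\frac{16\gamma_1^2}{\epsilon_0}\log\frac{128\gamma_1^2}{\epsilon_0^2},$$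 $$\widehat\phi(T,\eta)=\kappa_0+\kappa_1+(\kappa_1\beta+\kappa_4)T^{-1/4}+\kappa_3T^{-3/4}+16\beta\frac{\gamma_1^2}{\epsilon_0}\big(\eta+\log(T+1)\big)T^{-1/4}.$$ **Algorithm (PMQSopt).** Let $T$ be an integer with $$T>\max\big\{\beta^2,\ \beta^{-1}p(\kappa_g+\kappa_\Sigma D_0/2)^2,\ (\kappa_\Sigma\gamma_2)^4\big\},$$ let $\sigma=T^{-3/4}$, $\alpha=\beta T^{1/4}$, $\tau=T^{1/2}$, and let $\xi_1,\xi_2,\dots$ be i.i.d. with distribution $P$. Start from a deterministic $x^1\in X_0$ and $\lambda^1=0\in\mathbb R^p$. For $t=1,\dots,T$ choose symmetric $n\times n$ matrices $\Sigma^t_1,\dots,\Sigma^t_p$ with $$\Sigma_i^t\preceq-L_iI,\qquad\|\Sigma^t_i\|\le\kappa_\Sigma\ \ (\text{spectral norm}),$$ put $\Sigma^t_0=-\sum_{i=1}^p\lambda^t_i\Sigma^t_i+\tau I$ and $$q_0^t(x)=F(x^t,\xi_t)+\langle\nabla_xF(x^t,\xi_t),x-x^t\rangle+\tfrac12\langle\Sigma^t_0(x-x^t),x-x^t\rangle,$$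 $$q_i^t(x)=G_i(x^t,\xi_t)+\langle\nabla_xG_i(x^t,\xi_t),x-x^t\rangle+\tfrac12\langle\Sigma^t_i(x-x^t),x-x^t\rangle,\quad i=1,\dots,p,$$ let $x^{t+1}$ be a minimizer over $x\in X_0$ of $$q^t_0(x)+\frac1{2\sigma}\Big[\sum_{i=1}^p[\lambda^t_i+\sigma q^t_i(x)]_+^2-\|\lambda^t\|^2\Big]+\frac\alpha2\|x-x^t\|^2,$$ and let $\lambda^{t+1}_i=[\lambda^t_i+\sigma q_i^t(x^{t+1})]_+$ for $i=1,\dots,p$. The iterates $x^t$ and $\lambda^t$ are measurable functions of the history $(\xi_1,\dots,\xi_{t-1})$. **Proposition.** For every $\eta>1$, $$\Pr\Big[-\sum_{t=1}^T\langle\lambda^t,g(x^t)\rangle\le p\,\eta\,\widehat\phi(T,\eta)\,\rho_c\,T^{1/2}+\frac{\nu_g^2}{2}T^{1/4}+\frac{\kappa_f^2}{2}\beta^{-1}T^{3/4}\Big]\ \ge\ 1-e^{-\eta}-2e^{-\eta^2/3}.$$ -/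

import Mathlib

open MeasureTheory ProbabilityTheory
open scoped RealInnerProductSpace

noncomputable section

namespace PMQS

/-- Euclidean space `ℝⁿ`. -/
abbrev Vec (n : ℕ) : Type := EuclideanSpace ℝ (Fin n)

/-- `f` is `L`-weakly convex over `s`: `f + (L/2)‖·‖²` is convex on `s`. -/
def WeaklyConvexOn {n : ℕ} (L : ℝ) (s : Set (Vec n)) (f : Vec n → ℝ) : Prop :=
  ConvexOn ℝ s (fun x => f x + L / 2 * ‖x‖ ^ 2)

/-- Data of the stochastic program
`min f(x) = E[F(x,ξ)]` over `x ∈ X₀` subject to `g_i(x) = E[G_i(x,ξ)] ≤ 0`, `i = 1,…,p`,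
where `ξ` has distribution `P`. The functions are only looked at on `O₀ × Ξ`. -/
structure Problem (n p q : ℕ) where
  X₀ : Set (Vec n)
  O₀ : Set (Vec n)
  Ξ : Set (Vec q)
  P : Measure (Vec q)
  F : Vec n → Vec q → ℝ
  G : Vec n → Vec q → Vec p

/-- The vector of expected constraint values `g(x) = E[G(x,ξ)]`. -/
def Problem.g {n p q : ℕ} (Q : Problem n p q) (x : Vec n) : Vec p :=
  WithLp.toLp 2 (fun i => ∫ z, Q.G x z i ∂Q.P)

/-- The standing setting of the stochastic program. -/
structure Problem.Standing {n p q : ℕ} (Q : Problem n p q) : Prop where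
  nonempty : Q.X₀.Nonempty
  isClosed : IsClosed Q.X₀
  convex : Convex ℝ Q.X₀
  isOpen_domain : IsOpen Q.O₀
  convex_domain : Convex ℝ Q.O₀
  subset_domain : Q.X₀ ⊆ Q.O₀
  isProbabilityMeasure : IsProbabilityMeasure Q.P
  supported : ∀ᵐ z ∂Q.P, z ∈ Q.Ξ
  integrable_F : ∀ x ∈ Q.O₀, Integrable (Q.F x) Q.P
  integrable_G : ∀ x ∈ Q.O₀, ∀ i, Integrable (fun z => Q.G x z i) Q.P
  differentiable_F : ∀ z ∈ Q.Ξ, ∀ x ∈ Q.O₀, DifferentiableAt ℝ (fun y => Q.F y z) x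
  differentiable_G : ∀ z ∈ Q.Ξ, ∀ x ∈ Q.O₀, ∀ i, DifferentiableAt ℝ (fun y => Q.G y z i) x

/-- The numerical constants that appear in the assumptions. -/
structure Constants (p : ℕ) where
  D₀ : ℝ
  νg : ℝ
  κf : ℝ
  κg : ℝ
  κS : ℝ
  ε₀ : ℝ
  L₀ : ℝ
  L : Fin p → ℝ

namespace Constants

variable {p : ℕ} (c : Constants p)

def γ₁ : ℝ := c.νg + √(p : ℝ) * (c.κg * c.D₀ + 1 / 2 * c.κS * c.D₀ ^ 2)

def γ₂ : ℝ := c.νg + (c.κg * c.D₀ + c.κS * c.D₀ ^ 2 / 2)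

def β : ℝ := 2 * (c.L₀ + ∑ j, c.γ₂ * c.L j) + 1

def κ₀ : ℝ := 4 * c.κf * c.D₀ / c.ε₀

def κ₁ : ℝ := 2 * c.D₀ ^ 2 / c.ε₀

def κ₃ : ℝ := 2 * c.νg ^ 2 / c.ε₀ - c.γ₁

def κ₄ : ℝ :=
  2 * c.γ₁ + c.ε₀ / 4 + 16 * c.γ₁ ^ 2 / c.ε₀ * Real.log (128 * c.γ₁ ^ 2 / c.ε₀ ^ 2)

/-- The quantity `φ̂(T,η)`. -/
def phiHat (T : ℕ) (η : ℝ) : ℝ :=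
  c.κ₀ + c.κ₁ + (c.κ₁ * c.β + c.κ₄) * (T : ℝ) ^ (-(1 / 4) : ℝ)
    + c.κ₃ * (T : ℝ) ^ (-(3 / 4) : ℝ)
    + 16 * c.β * (c.γ₁ ^ 2 / c.ε₀) * (η + Real.log ((T : ℝ) + 1)) * (T : ℝ) ^ (-(1 / 4) : ℝ)

/-- The bound `π_cm(T,η)` on the total complementarity violation. -/
def piCm (ρc : ℝ) (T : ℕ) (η : ℝ) : ℝ :=
  p * η * c.phiHat T η * ρc * (T : ℝ) ^ (1 / 2 : ℝ)
    + c.νg ^ 2 / 2 * (T : ℝ) ^ (1 / 4 : ℝ)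
    + c.κf ^ 2 / 2 * c.β⁻¹ * (T : ℝ) ^ (3 / 4 : ℝ)

end Constants

/-- Boundedness, Slater and weak convexity assumptions on the problem functions, and
positivity of the constants. -/
structure Problem.Regular {n p q : ℕ} (Q : Problem n p q) (c : Constants p) : Prop where
  D₀_pos : 0 < c.D₀
  νg_pos : 0 < c.νg
  κf_pos : 0 < c.κf
  κg_pos : 0 < c.κg
  κS_pos : 0 < c.κS
  ε₀_pos : 0 < c.ε₀
  L₀_pos : 0 < c.L₀
  L_pos : ∀ i, 0 < c.L i
  diam_le : ∀ x ∈ Q.X₀, ∀ z ∈ Q.X₀, ‖x - z‖ ≤ c.D₀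
  norm_G_le : ∀ x ∈ Q.O₀, ∀ z ∈ Q.Ξ, ‖Q.G x z‖ ≤ c.νg
  norm_grad_F_le : ∀ x ∈ Q.O₀, ∀ z ∈ Q.Ξ, ‖gradient (fun y => Q.F y z) x‖ ≤ c.κf
  norm_grad_G_le : ∀ x ∈ Q.O₀, ∀ z ∈ Q.Ξ, ∀ i, ‖gradient (fun y => Q.G y z i) x‖ ≤ c.κg
  slater : ∃ xhat ∈ Q.X₀, ∀ i, Q.g xhat i ≤ -c.ε₀
  weaklyConvex_F : ∀ z ∈ Q.Ξ, WeaklyConvexOn c.L₀ Q.O₀ (fun y => Q.F y z)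
  weaklyConvex_G : ∀ z ∈ Q.Ξ, ∀ i, WeaklyConvexOn (c.L i) Q.O₀ (fun y => Q.G y z i)

/-- Light-tail assumption on the constraint functions with parameter `ρc`. -/
structure Problem.LightTail {n p q : ℕ} (Q : Problem n p q) (ρc : ℝ) : Prop where
  ρc_pos : 0 < ρc
  exp_moment : ∀ x ∈ Q.X₀, ∀ i,
    ∫ z, Real.exp ((Q.G x z i - Q.g x i) ^ 2 / ρc ^ 2) ∂Q.P ≤ Real.exp 1

/-- Quadratic model of `h` at `a` with Hessian `S`:
`h(a) + ⟨∇h(a), x - a⟩ + ½⟨S(x - a), x - a⟩`. -/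
def quadModel {n : ℕ} (h : Vec n → ℝ) (S : Vec n →L[ℝ] Vec n) (a x : Vec n) : ℝ :=
  h a + ⟪gradient h a, x - a⟫ + 1 / 2 * ⟪S (x - a), x - a⟫

/-- `Σ₀ = -∑ λ_i Σ_i + τ I`. -/
def sigmaZero {n p : ℕ} (τ : ℝ) (S : Fin p → Vec n →L[ℝ] Vec n) (lam : Vec p) :
    Vec n →L[ℝ] Vec n :=
  -(∑ i, lam i • S i) + τ • ContinuousLinearMap.id ℝ (Vec n)

/-- Augmented Lagrangian `𝓛_σ(x,λ)` of the quadratic models at `a` for the sample `z`, with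
`Σ_i = S i` for `i = 1,…,p` and `Σ₀ = S₀`. -/
def augLagrangian {n p q : ℕ} (Q : Problem n p q) (σ : ℝ) (S₀ : Vec n →L[ℝ] Vec n)
    (S : Fin p → Vec n →L[ℝ] Vec n) (z : Vec q) (a : Vec n) (lam : Vec p) (x : Vec n) : ℝ :=
  quadModel (fun y => Q.F y z) S₀ a x
    + 1 / (2 * σ) *
      ((∑ i, (max (lam i + σ * quadModel (fun y => Q.G y z i) (S i) a x) 0) ^ 2) - ‖lam‖ ^ 2)

/-- `(x^t)` and `(λ^t)`, `1 ≤ t ≤ T + 1`, are produced by `T` iterations of PMQSopt with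
parameters `σ, α, τ` along the sample path `z_1,…,z_T`, with the matrices `Σ_i^t = S t i`. -/
structure IsPMQSoptRun {n p q : ℕ} (Q : Problem n p q) (σ α τ : ℝ) (T : ℕ)
    (z : ℕ → Vec q) (S : ℕ → Fin p → Vec n →L[ℝ] Vec n)
    (x : ℕ → Vec n) (lam : ℕ → Vec p) : Prop where
  start_mem : x 1 ∈ Q.X₀
  start_multiplier : lam 1 = 0
  step_mem : ∀ t ∈ Finset.Icc 1 T, x (t + 1) ∈ Q.X₀
  step_min : ∀ t ∈ Finset.Icc 1 T,
    IsMinOn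
      (fun y => augLagrangian Q σ (sigmaZero τ (S t) (lam t)) (S t) (z t) (x t) (lam t) y
        + α / 2 * ‖y - x t‖ ^ 2)
      Q.X₀ (x (t + 1))
  step_multiplier : ∀ t ∈ Finset.Icc 1 T, ∀ i,
    lam (t + 1) i =
      max (lam t i + σ * quadModel (fun y => Q.G y (z t) i) (S t i) (x t) (x (t + 1))) 0

/-- Admissible choice of the matrices `Σ_i^t`, `1 ≤ t ≤ T`, `1 ≤ i ≤ p`: symmetric,
`Σ_i^t ≼ -L_i I` in the Loewner order, and spectral norm at most `κS`. -/
structure AdmissibleMatrices {n p : ℕ} (c : Constants p) (T : ℕ)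
    (S : ℕ → Fin p → Vec n →L[ℝ] Vec n) : Prop where
  symmetric : ∀ t ∈ Finset.Icc 1 T, ∀ i, IsSelfAdjoint (S t i)
  le_neg : ∀ t ∈ Finset.Icc 1 T, ∀ i, S t i ≤ -(c.L i • ContinuousLinearMap.id ℝ (Vec n))
  norm_le : ∀ t ∈ Finset.Icc 1 T, ∀ i, ‖S t i‖ ≤ c.κS

/-- The σ-algebra generated by the history `ξ_1,…,ξ_{t-1}`. -/
@[reducible] def history {Ω : Type*} {q : ℕ} (ξ : ℕ → Ω → Vec q) (t : ℕ) : MeasurableSpace Ω :=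
  ⨆ j ∈ Finset.Ico 1 t, MeasurableSpace.comap (ξ j) inferInstance

end PMQS

end

/-! Write `-∑⟨λ^t, g(x^t)⟩` as `∑⟨λ^t, G(x^t,ξ_t) - g(x^t)⟩ - ∑⟨λ^t, G(x^t,ξ_t)⟩`.

The sampled part is deterministic. Comparing `x^{t+1}` with the competitor `x^t` bounds `-⟨λ^t,
G(x^t,ξ_t)⟩` by a telescoping term in `‖λ^t‖²` plus `σν_g²/2 + κ_f²/(2α)` (`complementarity_step`).
Since `λ^1 = 0`, summation gives exactly the last two terms of the bound
(`IsPMQSoptRun.sum_complementarity_le`).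

The noise part is a sum of martingale differences, because `x^t` and `λ^t` depend only on the past.
While `‖λ^t‖ ≤ φ`, each term has conditional moment generating function at most `exp(3u²s²/4)` with
`s = pφρ_c` (`integral_exp_mul_le_of_exp_sq`, `lintegral_exp_inner_le`). With the multipliers
truncated at `φ`, a Chernoff bound gives failure probability `exp(-η²/3)`
(`measure_truncSum_ge_le`).

It remains to keep all `‖λ^t‖` below `φ = φ̂(T,η)`. First-order optimality tested at the Slater
point makes `√(‖λ‖² + σ(α+τ)‖x̂ - x‖²)` drift downwards once it is large (`multiplier_drift`). Its
exponential moment therefore grows at most linearly in `t` (`lintegral_exp_drift_le`,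
`lintegral_exp_lyapunov_le`), and Markov's inequality with a union bound costs `exp(-η)`
(`measure_exists_norm_multiplier_gt_le`). `threshold_le_phiHat` checks that `φ̂` is large enough.
The total failure probability is `exp(-η) + exp(-η²/3)`, within the allowance. -/

namespace PMQS

/-! ### Moment generating function from a squared-exponential moment -/

section ExpInequality

/-- The reason is `(1 + x + x²/2)(1 - x + x²/2) = 1 + x⁴/4 ≥ 1`, combined with the Taylor lower
bound for `exp (-x)`. -/
lemma exp_le_quadratic_of_nonpos {x : ℝ} (hx : x ≤ 0) : Real.exp x ≤ 1 + x + x ^ 2 / 2 := by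
  have h1 : 1 + (-x) + (-x) ^ 2 / 2 ≤ Real.exp (-x) :=
    Real.quadratic_le_exp_of_nonneg (by linarith)
  have h2 : Real.exp x * Real.exp (-x) = 1 := by rw [← Real.exp_add]; simp
  have h3 : 0 < 1 + x + x ^ 2 / 2 := by nlinarith [sq_nonneg (x + 1)]
  have h4 : Real.exp x * (1 + (-x) + (-x) ^ 2 / 2) ≤ 1 :=
    (mul_le_mul_of_nonneg_left h1 (Real.exp_pos x).le).trans_eq h2
  have h5 : 0 < 1 + (-x) + (-x) ^ 2 / 2 := by nlinarith [sq_nonneg x]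
  refine le_of_mul_le_mul_right (h4.trans ?_) h5
  nlinarith [sq_nonneg (x ^ 2)]

lemma exp_le_add_exp_sq_of_mem_unit {x : ℝ} (h0 : 0 ≤ x) (h1 : x ≤ 1) :
    Real.exp x ≤ x + Real.exp (9 / 16 * x ^ 2) := by
  have hu := Real.exp_bound' h0 h1 (n := 5) (by norm_num)
  have hl := Real.sum_le_exp_of_nonneg (x := 9 / 16 * x ^ 2) (by positivity) 4
  simp only [Finset.sum_range_succ, Finset.sum_range_zero, Nat.factorial] at hu hl
  norm_num at hu hl
  -- The right side's cubic Taylor minorant in `9x²/16`, minus the quartic majorant of `exp x` with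
  -- remainder `x⁵/100`, divided by `x²`.
  have key : 0 ≤ 1 / 16 - x / 6 + (81 / 512 - 1 / 24) * x ^ 2 - x ^ 3 / 100
      + 243 / 8192 * x ^ 4 := by
    nlinarith [sq_nonneg (x ^ 2 - 43 / 100), sq_nonneg (x - 66 / 100),
      sq_nonneg (x ^ 2 - x * (17 / 100) - 32 / 100)]
  have := mul_nonneg (sq_nonneg x) key
  nlinarith

/-- After multiplication by `exp (-y)` the right side is nondecreasing on `[1, ∞)`, and at `y = 1`
it is at least 1 by the previous case. -/
lemma exp_le_add_exp_sq_of_one_le {x : ℝ} (h1 : 1 ≤ x) :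
    Real.exp x ≤ x + Real.exp (9 / 16 * x ^ 2) := by
  let k : ℝ → ℝ := fun y => Real.exp (-y) * (y + Real.exp (9 / 16 * y ^ 2))
  have hd : ∀ y, HasDerivAt k (-Real.exp (-y) * (y + Real.exp (9 / 16 * y ^ 2))
      + Real.exp (-y) * (1 + Real.exp (9 / 16 * y ^ 2) * (9 / 16 * (2 * y)))) y := by
    intro y
    have ha : HasDerivAt (fun y : ℝ => Real.exp (-y)) (-Real.exp (-y)) y := by
      simpa using (hasDerivAt_neg y).exp
    have hb : HasDerivAt (fun y : ℝ => 9 / 16 * y ^ 2) (9 / 16 * (2 * y)) y := by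
      simpa using (hasDerivAt_pow 2 y).const_mul (9 / 16 : ℝ)
    exact ha.mul ((hasDerivAt_id y).add hb.exp)
  have hmono : MonotoneOn k (Set.Ici 1) := by
    refine monotoneOn_of_deriv_nonneg (convex_Ici 1)
      (fun y _ => (hd y).continuousAt.continuousWithinAt)
      (fun y _ => (hd y).differentiableAt.differentiableWithinAt) fun y hy => ?_
    rw [interior_Ici, Set.mem_Ioi] at hy
    rw [(hd y).deriv]
    have hexp : 9 / 16 * y ^ 2 + 1 ≤ Real.exp (9 / 16 * y ^ 2) := Real.add_one_le_exp _
    have h2 : 0 ≤ (9 / 8 * y - 1) * Real.exp (9 / 16 * y ^ 2) + 1 - y := by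
      have := mul_le_mul_of_nonneg_left hexp (by linarith : 0 ≤ 9 / 8 * y - 1)
      nlinarith [mul_nonneg (mul_self_nonneg y) (by linarith : 0 ≤ y - 1)]
    have := mul_nonneg (Real.exp_pos (-y)).le h2
    linarith
  have hk1 : 1 ≤ k 1 := by
    have h := mul_le_mul_of_nonneg_left (exp_le_add_exp_sq_of_mem_unit zero_le_one le_rfl)
      (Real.exp_pos (-1)).le
    rwa [← Real.exp_add, neg_add_cancel, Real.exp_zero] at h
  have h := mul_le_mul_of_nonneg_left (hk1.trans (hmono Set.self_mem_Ici h1 h1))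
    (Real.exp_pos x).le
  have he : Real.exp x * Real.exp (-x) = 1 := by rw [← Real.exp_add]; simp
  rwa [mul_one, ← mul_assoc, he, one_mul] at h

lemma exp_le_add_exp_sq (x : ℝ) : Real.exp x ≤ x + Real.exp (9 / 16 * x ^ 2) := by
  rcases le_total x 0 with h | h
  · have := exp_le_quadratic_of_nonpos h
    have := Real.add_one_le_exp (9 / 16 * x ^ 2)
    nlinarith [sq_nonneg x]
  · rcases le_total x 1 with h1 | h1
    · exact exp_le_add_exp_sq_of_mem_unit h h1
    · exact exp_le_add_exp_sq_of_one_le h1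

/-- Convexity of the exponential along the segment from `c` to `c + (w - 1)`. -/
lemma exp_mul_le_of_mem_unit {c : ℝ} (h0 : 0 ≤ c) (h1 : c ≤ 1) (w : ℝ) :
    Real.exp (c * w) ≤ Real.exp c * (c * (Real.exp w / Real.exp 1) + (1 - c)) := by
  have h := convexOn_exp.2 (Set.mem_univ (w - 1)) (Set.mem_univ 0) h0 (sub_nonneg.2 h1)
    (by ring)
  simp only [smul_eq_mul, mul_zero, add_zero, Real.exp_zero, mul_one] at h
  rw [Real.exp_sub] at h
  have := mul_le_mul_of_nonneg_left h (Real.exp_pos c).le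
  rwa [← Real.exp_add, show c + c * (w - 1) = c * w by ring] at this

/-- A centred random variable with `E[exp(X²/s²)] ≤ e` satisfies `E[exp(uX)] ≤ exp(3u²s²/4)`. -/
lemma integral_exp_mul_le_of_exp_sq {α : Type*} [MeasurableSpace α] {P : Measure α}
    [IsProbabilityMeasure P] {X : α → ℝ} {s u : ℝ} (hs : 0 < s) (hu : 0 ≤ u)
    (hX : Integrable X P) (hX0 : ∫ a, X a ∂P = 0)
    (hint : Integrable (fun a => Real.exp (X a ^ 2 / s ^ 2)) P)
    (hle : ∫ a, Real.exp (X a ^ 2 / s ^ 2) ∂P ≤ Real.exp 1) :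
    ∫ a, Real.exp (u * X a) ∂P ≤ Real.exp (3 / 4 * u ^ 2 * s ^ 2) := by
  -- Jensen's inequality `E[exp(cX²/s²)] ≤ e^c` through the convexity chord; the linear term `vX`
  -- disappears because `X` is centred.
  have aux : ∀ c v : ℝ, 0 ≤ c → c ≤ 1 →
      ∫ a, (v * X a + Real.exp c * (c * (Real.exp (X a ^ 2 / s ^ 2) / Real.exp 1) + (1 - c))) ∂P
        ≤ Real.exp c := by
    intro c v h0 h1
    have i1 : Integrable (fun a => c * (Real.exp (X a ^ 2 / s ^ 2) / Real.exp 1)) P :=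
      (hint.div_const _).const_mul c
    have i2 : Integrable (fun a => Real.exp c *
        (c * (Real.exp (X a ^ 2 / s ^ 2) / Real.exp 1) + (1 - c))) P :=
      (i1.add (integrable_const _)).const_mul _
    rw [integral_add (hX.const_mul v) i2,
      integral_const_mul, hX0, integral_const_mul, integral_add i1 (integrable_const _),
      integral_const_mul, integral_div]
    simp only [integral_const, probReal_univ, smul_eq_mul, one_mul, mul_zero, zero_add]
    have : (∫ a, Real.exp (X a ^ 2 / s ^ 2) ∂P) / Real.exp 1 ≤ 1 :=
      (div_le_one (Real.exp_pos 1)).2 hle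
    nlinarith [Real.exp_pos c, mul_le_mul_of_nonneg_left this h0]
  have hdom : ∀ c v : ℝ, Integrable (fun a => v * X a + Real.exp c *
      (c * (Real.exp (X a ^ 2 / s ^ 2) / Real.exp 1) + (1 - c))) P := fun c v =>
    (hX.const_mul v).add ((((hint.div_const _).const_mul c).add (integrable_const _)).const_mul _)
  -- For small `us` the linear term must be kept, so that centring is used; this gives the constant
  -- `9/16 ≤ 3/4`. For large `us`, Young's inequality suffices: the extra `2/3` in the exponent is
  -- absorbed since `(us)² > 16/9` means `2/3 < (3/8)(us)²`.
  by_cases hc : 9 / 16 * (u * s) ^ 2 ≤ 1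
  · have hpt : ∀ a, Real.exp (u * X a) ≤ u * X a + Real.exp (9 / 16 * (u * s) ^ 2) *
        (9 / 16 * (u * s) ^ 2 * (Real.exp (X a ^ 2 / s ^ 2) / Real.exp 1)
          + (1 - 9 / 16 * (u * s) ^ 2)) := by
      intro a
      have h1 := exp_le_add_exp_sq (u * X a)
      have h2 := exp_mul_le_of_mem_unit (by positivity) hc (X a ^ 2 / s ^ 2)
      have h3 : 9 / 16 * (u * X a) ^ 2 = 9 / 16 * (u * s) ^ 2 * (X a ^ 2 / s ^ 2) := by
        field_simp
      rw [h3] at h1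
      linarith
    refine (integral_mono_of_nonneg (ae_of_all _ fun a => (Real.exp_pos _).le) (hdom _ _)
      (ae_of_all _ hpt)).trans ((aux _ _ (by positivity) hc).trans ?_)
    apply Real.exp_le_exp.2
    nlinarith [sq_nonneg (u * s)]
  · have hpt : ∀ a, Real.exp (u * X a) ≤ Real.exp (3 / 8 * (u * s) ^ 2) * (0 * X a +
        Real.exp (2 / 3) * (2 / 3 * (Real.exp (X a ^ 2 / s ^ 2) / Real.exp 1)
          + (1 - 2 / 3))) := by
      intro a
      have h2 := exp_mul_le_of_mem_unit (by norm_num) (by norm_num : (2 / 3 : ℝ) ≤ 1)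
        (X a ^ 2 / s ^ 2)
      have h3 : u * X a ≤ 3 / 8 * (u * s) ^ 2 + 2 / 3 * (X a ^ 2 / s ^ 2) := by
        have : X a = s * (X a / s) := by field_simp
        rw [← div_pow]
        nlinarith [sq_nonneg (3 / 4 * (u * s) - X a / s)]
      rw [zero_mul, zero_add]
      calc _ ≤ _ := Real.exp_le_exp.2 h3
        _ = _ := Real.exp_add _ _
        _ ≤ _ := mul_le_mul_of_nonneg_left h2 (Real.exp_pos _).le
    refine (integral_mono_of_nonneg (ae_of_all _ fun a => (Real.exp_pos _).le)
      ((hdom (2 / 3) 0).const_mul _) (ae_of_all _ hpt)).trans ?_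
    rw [integral_const_mul]
    refine (mul_le_mul_of_nonneg_left (aux (2 / 3) 0 (by norm_num) (by norm_num))
      (Real.exp_pos _).le).trans ?_
    rw [← Real.exp_add]
    apply Real.exp_le_exp.2
    nlinarith

end ExpInequality

/-! ### Weak convexity and optimality of one step -/

section Step

variable {n p q : ℕ}

lemma WeaklyConvexOn.add_inner_gradient_le {L : ℝ} {s : Set (Vec n)} {f : Vec n → ℝ}
    (h : WeaklyConvexOn L s f) {x z : Vec n} (hx : x ∈ s) (hz : z ∈ s)
    (hf : DifferentiableAt ℝ f x) :
    f x + ⟪gradient f x, z - x⟫ ≤ f z + L / 2 * ‖z - x‖ ^ 2 := by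
  set e := z - x with he
  have hline : HasDerivAt (fun t : ℝ => x + t • e) e 0 := by
    simpa using ((hasDerivAt_id (0 : ℝ)).smul_const e).const_add x
  have hd : HasDerivAt (fun t : ℝ => f (x + t • e)) ⟪gradient f x, e⟫ 0 := by
    have h0 : HasFDerivAt f (InnerProductSpace.toDual ℝ (Vec n) (gradient f x))
        (x + (0 : ℝ) • e) := by
      simpa using hf.hasGradientAt.hasFDerivAt
    exact h0.comp_hasDerivAt (0 : ℝ) hline
  have htend := hd.tendsto_slope_zero_right
  -- Weak convexity on the segment bounds the difference quotient for every `t` in `(0,1)`; the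
  -- gradient inequality is the limit `t ↓ 0`.
  have hbound : ∀ᶠ t : ℝ in nhdsWithin 0 (Set.Ioi 0),
      t⁻¹ • (f (x + (0 + t) • e) - f (x + (0 : ℝ) • e)) ≤ f z - f x + L / 2 * ‖e‖ ^ 2 * (1 - t) := by
    filter_upwards [Ioo_mem_nhdsGT (zero_lt_one' ℝ)] with t ht
    have hc := h.2 hx hz (sub_nonneg.2 ht.2.le) ht.1.le (by ring)
    have hpt : (1 - t) • x + t • z = x + t • e := by rw [he]; module
    have hz' : z = x + e := by rw [he]; abel
    have n1 : ‖x + t • e‖ ^ 2 = ‖x‖ ^ 2 + 2 * (t * ⟪x, e⟫) + t ^ 2 * ‖e‖ ^ 2 := by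
      rw [norm_add_sq_real, inner_smul_right, norm_smul, mul_pow, Real.norm_eq_abs, sq_abs]
    have n2 : ‖z‖ ^ 2 = ‖x‖ ^ 2 + 2 * ⟪x, e⟫ + ‖e‖ ^ 2 := by rw [hz', norm_add_sq_real]
    simp only [hpt, smul_eq_mul, n1, n2] at hc
    rw [zero_add, zero_smul, add_zero, smul_eq_mul, inv_mul_le_iff₀ ht.1]
    nlinarith
  have hlim : Filter.Tendsto (fun t : ℝ => f z - f x + L / 2 * ‖e‖ ^ 2 * (1 - t))
      (nhdsWithin 0 (Set.Ioi 0)) (nhds (f z - f x + L / 2 * ‖e‖ ^ 2 * (1 - 0))) :=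
    (Continuous.tendsto (by fun_prop) 0).mono_left nhdsWithin_le_nhds
  have := le_of_tendsto_of_tendsto htend hlim hbound
  linarith

lemma quadModel_add_smul (h : Vec n → ℝ) {S : Vec n →L[ℝ] Vec n} (hS : ∀ u v, ⟪S u, v⟫ = ⟪S v, u⟫)
    (a x d : Vec n) (s : ℝ) :
    quadModel h S a (x + s • d) = quadModel h S a x
      + (s * (⟪gradient h a, d⟫ + ⟪S (x - a), d⟫) + s ^ 2 * (1 / 2 * ⟪S d, d⟫)) := by
  have h1 : x + s • d - a = (x - a) + s • d := by abel
  have h2 : ⟪S d, x - a⟫ = ⟪S (x - a), d⟫ := hS _ _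
  simp only [quadModel, h1, map_add, map_smul, inner_add_left, inner_add_right,
    inner_smul_left, inner_smul_right, h2, RCLike.conj_to_real]
  ring

lemma inner_sigmaZero (S : Fin p → Vec n →L[ℝ] Vec n) (τ : ℝ) (lam : Vec p) (u v : Vec n) :
    ⟪sigmaZero τ S lam u, v⟫ = τ * ⟪u, v⟫ - ∑ i, lam i * ⟪S i u, v⟫ := by
  simp [sigmaZero, inner_add_left, inner_neg_left, inner_smul_left, sum_inner]
  ring

lemma inner_sigmaZero_comm {S : Fin p → Vec n →L[ℝ] Vec n} (hS : ∀ i u v, ⟪S i u, v⟫ = ⟪S i v, u⟫)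
    (τ : ℝ) (lam : Vec p) (u v : Vec n) :
    ⟪sigmaZero τ S lam u, v⟫ = ⟪sigmaZero τ S lam v, u⟫ := by
  simp only [inner_sigmaZero, hS _ u v, real_inner_comm u v]

lemma nonneg_of_forall_quadratic_nonneg {D K : ℝ}
    (h : ∀ s, 0 < s → s ≤ 1 → 0 ≤ s * D + s ^ 2 * K) : 0 ≤ D := by
  by_contra! hD
  have hpos : 0 < -D / (2 * (|K| + 1)) := by apply div_pos <;> [linarith; positivity]
  have hs := h (min 1 (-D / (2 * (|K| + 1)))) (lt_min one_pos hpos) (min_le_left _ _)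
  set s := min 1 (-D / (2 * (|K| + 1)))
  have hs0 : 0 < s := lt_min one_pos hpos
  have h2 : s * (2 * (|K| + 1)) ≤ -D := (le_div_iff₀ (by positivity)).1 (min_le_right _ _)
  have h3 : s * K ≤ s * |K| := mul_le_mul_of_nonneg_left (le_abs_self K) hs0.le
  nlinarith [mul_pos hs0 (show 0 < -(D + s * K) by nlinarith)]

/-- A quadratic upper model of `[·]₊²` at `a` with slope `2[a]₊`. It replaces differentiation of the
penalty in the optimality condition. -/
lemma max_add_sq_le (a b : ℝ) : max (a + b) 0 ^ 2 ≤ (max a 0 + b) ^ 2 := by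
  rcases le_total (a + b) 0 with h | h
  · rw [max_eq_right h, zero_pow two_ne_zero]; exact sq_nonneg _
  · rw [max_eq_left h]
    exact pow_le_pow_left₀ h (by gcongr; exact le_max_left _ _) 2

/-- First-order optimality of the proximal augmented Lagrangian step. -/
lemma first_order_optimality (Q : Problem n p q) (hX : Convex ℝ Q.X₀) {σ α τ : ℝ} (hσ : 0 < σ)
    {S : Fin p → Vec n →L[ℝ] Vec n} (hS : ∀ i u v, ⟪S i u, v⟫ = ⟪S i v, u⟫)
    {ζ : Vec q} {a x z : Vec n} {lam lam' : Vec p} (hx : x ∈ Q.X₀) (hz : z ∈ Q.X₀)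
    (hmin : IsMinOn (fun y => augLagrangian Q σ (sigmaZero τ S lam) S ζ a lam y
        + α / 2 * ‖y - a‖ ^ 2) Q.X₀ x)
    (hlam : ∀ i, lam' i = max (lam i + σ * quadModel (fun y => Q.G y ζ i) (S i) a x) 0) :
    0 ≤ ⟪gradient (fun y => Q.F y ζ) a, z - x⟫ + (α + τ) * ⟪x - a, z - x⟫
      - ∑ i, lam i * ⟪S i (x - a), z - x⟫
      + ∑ i, lam' i * (⟪gradient (fun y => Q.G y ζ i) a, z - x⟫ + ⟪S i (x - a), z - x⟫) := by
  set d := z - x with hd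
  set l : Fin p → ℝ := fun i => ⟪gradient (fun y => Q.G y ζ i) a, d⟫ + ⟪S i (x - a), d⟫ with hl
  set m : Fin p → ℝ := fun i => 1 / 2 * ⟪S i d, d⟫ with hm
  -- The coefficient of `s²` must not depend on `s`; for `0 < s ≤ 1`, `(|l| + |m|)²` dominates `(l +
  -- s m)²`.
  refine nonneg_of_forall_quadratic_nonneg (K := 1 / 2 * ⟪sigmaZero τ S lam d, d⟫
    + α / 2 * ‖d‖ ^ 2 + ∑ i, (lam' i * m i + σ / 2 * (|l i| + |m i|) ^ 2)) fun s hs hs1 => ?_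
  have hy : x + s • d ∈ Q.X₀ := hX.add_smul_sub_mem hx hz ⟨hs.le, hs1⟩
  have h := hmin hy
  simp only [Set.mem_ofPred_eq, augLagrangian] at h
  rw [quadModel_add_smul _ (inner_sigmaZero_comm hS τ lam), inner_sigmaZero S τ lam (x - a) d]
    at h
  have hterm : ∀ i, 1 / (2 * σ) * max (lam i
      + σ * quadModel (fun y => Q.G y ζ i) (S i) a (x + s • d)) 0 ^ 2
      ≤ 1 / (2 * σ) * max (lam i + σ * quadModel (fun y => Q.G y ζ i) (S i) a x) 0 ^ 2
        + (s * (lam' i * l i) + s ^ 2 * (lam' i * m i + σ / 2 * (|l i| + |m i|) ^ 2)) := by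
    intro i
    rw [quadModel_add_smul _ (hS i), mul_add, ← add_assoc, ← hlam i]
    have h1 := max_add_sq_le (lam i + σ * quadModel (fun y => Q.G y ζ i) (S i) a x)
      (σ * (s * l i + s ^ 2 * m i))
    rw [← hlam i] at h1
    have h2 : (l i + s * m i) ^ 2 ≤ (|l i| + |m i|) ^ 2 := by
      rw [← sq_abs]
      refine pow_le_pow_left₀ (abs_nonneg _) ((abs_add_le _ _).trans ?_) 2
      rw [abs_mul, abs_of_pos hs]
      gcongr
      exact mul_le_of_le_one_left (abs_nonneg _) hs1
    have h3 : 1 / (2 * σ) * (lam' i + σ * (s * l i + s ^ 2 * m i)) ^ 2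
        = 1 / (2 * σ) * lam' i ^ 2 + (s * (lam' i * l i) + s ^ 2 * (lam' i * m i))
          + s ^ 2 * (σ / 2 * (l i + s * m i) ^ 2) := by
      field_simp; ring
    have h4 := mul_le_mul_of_nonneg_left h1 (by positivity : 0 ≤ 1 / (2 * σ))
    have h5 := mul_le_mul_of_nonneg_left h2 (by positivity : 0 ≤ s ^ 2 * (σ / 2))
    rw [h3] at h4
    linarith
  have hsum := Finset.sum_le_sum fun i (_ : i ∈ Finset.univ) => hterm i
  rw [Finset.sum_add_distrib, Finset.sum_add_distrib, ← Finset.mul_sum, ← Finset.mul_sum,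
    ← Finset.mul_sum, ← Finset.mul_sum] at hsum
  have hn : ‖x + s • d - a‖ ^ 2 = ‖x - a‖ ^ 2 + 2 * (s * ⟪x - a, d⟫) + s ^ 2 * ‖d‖ ^ 2 := by
    rw [show x + s • d - a = (x - a) + s • d by abel, norm_add_sq_real, inner_smul_right,
      norm_smul, mul_pow, Real.norm_eq_abs, sq_abs]
  rw [hn] at h
  nlinarith

end Step

/-! ### One-step inequalities: multiplier drift and complementarity -/

section Drift

variable {n p q : ℕ}

lemma inner_eq_sum (u v : Vec p) : ⟪u, v⟫ = ∑ i, u i * v i := by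
  simp [PiLp.inner_apply, mul_comm]

lemma sum_le_sqrt_mul_norm (u : Vec p) : ∑ i, u i ≤ √(p : ℝ) * ‖u‖ := by
  have h := real_inner_le_norm u (WithLp.toLp 2 (fun _ => (1 : ℝ)))
  rw [inner_eq_sum] at h
  have h1 : ‖(WithLp.toLp 2 (fun _ => (1 : ℝ)) : Vec p)‖ = √(p : ℝ) := by
    simp [EuclideanSpace.norm_eq]
  rw [h1, mul_comm] at h
  simpa using h

lemma norm_le_sum_of_nonneg {u : Vec p} (hu : ∀ i, 0 ≤ u i) : ‖u‖ ≤ ∑ i, u i := by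
  rw [EuclideanSpace.norm_eq]
  refine Real.sqrt_le_iff.2 ⟨Finset.sum_nonneg fun i _ => hu i, ?_⟩
  simp only [Real.norm_eq_abs, sq_abs]
  exact Finset.sum_sq_le_sq_sum_of_nonneg fun i _ => hu i

lemma norm_le_sqrt_mul_of_forall_abs_le {u : Vec p} {K : ℝ} (hK : 0 ≤ K) (hu : ∀ i, |u i| ≤ K) :
    ‖u‖ ≤ √(p : ℝ) * K := by
  rw [EuclideanSpace.norm_eq, ← Real.sqrt_sq hK, ← Real.sqrt_mul (Nat.cast_nonneg p)]
  refine Real.sqrt_le_sqrt ?_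
  calc ∑ i, ‖u i‖ ^ 2 ≤ ∑ _i : Fin p, K ^ 2 :=
        Finset.sum_le_sum fun i _ => pow_le_pow_left₀ (norm_nonneg _) (hu i) 2
    _ = p * K ^ 2 := by simp

lemma inner_sub_split {S : Vec n →L[ℝ] Vec n} (hS : ∀ u v, ⟪S u, v⟫ = ⟪S v, u⟫) (u v : Vec n) :
    ⟪S u, v⟫ = 1 / 2 * (⟪S (u + v), u + v⟫ - ⟪S u, u⟫ - ⟪S v, v⟫) := by
  simp only [map_add, inner_add_left, inner_add_right, hS v u]
  ring

/-- One-step drift of `‖λ‖² + σ(α + τ)‖z - x‖²`. -/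
lemma multiplier_drift {Q : Problem n p q} {c : Constants p} (hQ : Q.Standing) (hreg : Q.Regular c)
    (hκε : √(p : ℝ) * c.κS * c.D₀ ^ 2 ≤ c.ε₀) {σ α τ : ℝ} (hσ : 0 < σ) (hατ : 0 ≤ α + τ)
    {S : Fin p → Vec n →L[ℝ] Vec n} (hS : ∀ i u v, ⟪S i u, v⟫ = ⟪S i v, u⟫)
    (hSlo : ∀ i v, -(c.κS * ‖v‖ ^ 2) ≤ ⟪S i v, v⟫) (hSup : ∀ i v, ⟪S i v, v⟫ ≤ -(c.L i * ‖v‖ ^ 2))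
    {ζ : Vec q} (hζ : ζ ∈ Q.Ξ) {a x z : Vec n} {lam lam' : Vec p}
    (ha : a ∈ Q.X₀) (hx : x ∈ Q.X₀) (hz : z ∈ Q.X₀) (hlam0 : ∀ i, 0 ≤ lam i)
    (hmin : IsMinOn (fun y => augLagrangian Q σ (sigmaZero τ S lam) S ζ a lam y
        + α / 2 * ‖y - a‖ ^ 2) Q.X₀ x)
    (hlam : ∀ i, lam' i = max (lam i + σ * quadModel (fun y => Q.G y ζ i) (S i) a x) 0) :
    ‖lam'‖ ^ 2 + σ * (α + τ) * ‖z - x‖ ^ 2 ≤ ‖lam‖ ^ 2 + σ * (α + τ) * ‖z - a‖ ^ 2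
      + 2 * σ * (c.κf * c.D₀ + σ * c.γ₁ ^ 2 / 2 + ⟪lam, Q.G z ζ⟫ + c.ε₀ / 2 * ‖lam‖) := by
  have hopt := first_order_optimality Q hQ.convex hσ hS hx hz hmin hlam
  have haO := hQ.subset_domain ha
  have hzO := hQ.subset_domain hz
  have hD0 := hreg.D₀_pos
  have hκS := hreg.κS_pos
  have hκg := hreg.κg_pos
  have hnd : ‖z - x‖ ^ 2 ≤ c.D₀ ^ 2 :=
    pow_le_pow_left₀ (norm_nonneg _) (hreg.diam_le z hz x hx) 2
  have hne : ‖z - a‖ ^ 2 ≤ c.D₀ ^ 2 :=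
    pow_le_pow_left₀ (norm_nonneg _) (hreg.diam_le z hz a ha) 2
  set d := z - x with hd
  set Δ := x - a with hΔ
  set e := z - a with he
  have hsplit : e = Δ + d := by rw [he, hd, hΔ]; abel
  set gG : Fin p → Vec n := fun i => gradient (fun y => Q.G y ζ i) a with hgG
  -- `b i` is the linearization at `x` of the quadratic model `q_i`, evaluated at `z`. The two
  -- curvature terms lie in `[-κ_ΣD₀²/2, 0]` and `[0, κ_ΣD₀²/2]`, so their sum has absolute value at
  -- most `κ_ΣD₀²/2`, as `γ₁` requires.
  set b : Vec p := WithLp.toLp 2 fun i =>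
    Q.G a ζ i + (⟪gG i, e⟫ + (1 / 2 * ⟪S i e, e⟫ - 1 / 2 * ⟪S i d, d⟫)) with hb
  have hb_norm : ‖b‖ ≤ c.γ₁ := by
    have hb' : b = Q.G a ζ + WithLp.toLp 2 fun i =>
        (⟪gG i, e⟫ + (1 / 2 * ⟪S i e, e⟫ - 1 / 2 * ⟪S i d, d⟫)) := by
      ext i; simp [hb]
    rw [hb', Constants.γ₁]
    refine (norm_add_le _ _).trans (add_le_add (hreg.norm_G_le a haO ζ hζ)
      (norm_le_sqrt_mul_of_forall_abs_le (by positivity) fun i => ?_))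
    have h1 : |⟪gG i, e⟫| ≤ c.κg * c.D₀ :=
      (abs_real_inner_le_norm _ _).trans (mul_le_mul (hreg.norm_grad_G_le a haO ζ hζ i)
        (hreg.diam_le z hz a ha) (norm_nonneg _) hκg.le)
    have hL := hreg.L_pos i
    have h2 := hSlo i e
    have h3 := hSup i e
    have h4 := hSlo i d
    have h5 := hSup i d
    have h6 := mul_le_mul_of_nonneg_left hnd hκS.le
    have h7 := mul_le_mul_of_nonneg_left hne hκS.le
    have h8 : 0 ≤ c.L i * ‖e‖ ^ 2 := by positivity
    have h9 : 0 ≤ c.L i * ‖d‖ ^ 2 := by positivity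
    refine (abs_add_le _ _).trans (add_le_add h1 (abs_le.2 ⟨?_, ?_⟩)) <;> linarith
  set Q' : Fin p → ℝ := fun i => quadModel (fun y => Q.G y ζ i) (S i) a x with hQ'
  have hq : ∀ i, Q' i = Q.G a ζ i + ⟪gG i, Δ⟫ + 1 / 2 * ⟪S i Δ, Δ⟫ := fun i => rfl
  have hge : ∀ i, ⟪gG i, e⟫ = ⟪gG i, Δ⟫ + ⟪gG i, d⟫ := fun i => by rw [hsplit, inner_add_right]
  have hSe : ∀ i, ⟪S i Δ, d⟫ = 1 / 2 * (⟪S i e, e⟫ - ⟪S i Δ, Δ⟫ - ⟪S i d, d⟫) := fun i => by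
    rw [hsplit]; exact inner_sub_split (hS i) Δ d
  -- The projection satisfies `λ'(λ + σq) = λ'²`; polarization does the rest.
  have hcompl : ∀ i, lam' i * Q' i
      = 1 / (2 * σ) * (lam' i ^ 2 - lam i ^ 2 + (lam' i - lam i) ^ 2) := by
    intro i
    have : lam' i * (lam i + σ * Q' i) = lam' i ^ 2 := by
      rw [hlam i]
      rcases le_total (lam i + σ * Q' i) 0 with h | h
      · rw [max_eq_right h]; simp
      · rw [max_eq_left h]; ring
    field_simp
    linarith
  -- Since `Σ_i ≼ -L_i I`, the weak-convexity defect `L_i‖e‖²/2` is at most `-½⟨Σ_i e, e⟩ ≤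
  -- κ_ΣD₀²/2`, and the `Δ` term is nonpositive.
  have hwc : ∀ i, Q.G a ζ i + ⟪gG i, e⟫ + 1 / 2 * ⟪S i Δ, Δ⟫
      ≤ Q.G z ζ i + 1 / 2 * (c.κS * c.D₀ ^ 2) := by
    intro i
    have h1 := (hreg.weaklyConvex_G ζ hζ i).add_inner_gradient_le haO hzO
      (hQ.differentiable_G ζ hζ a haO i)
    have hL := hreg.L_pos i
    have h2 := hSlo i e
    have h3 := hSup i e
    have h4 := hSup i Δ
    have h5 := mul_le_mul_of_nonneg_left hne hκS.le
    have h6 : 0 ≤ c.L i * ‖Δ‖ ^ 2 := by positivity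
    change Q.G a ζ i + ⟪gG i, e⟫ ≤ Q.G z ζ i + c.L i / 2 * ‖e‖ ^ 2 at h1
    linarith
  -- Split `λ'b = (λ' - λ)b + λb`. The term `-λ_iΣ_i` of `Σ₀` turns the curvature in `λb` into
  -- `½⟨Σ_iΔ, Δ⟩`, which is what `hwc` controls.
  have hsum : ∑ i, lam' i * (⟪gG i, d⟫ + ⟪S i Δ, d⟫) - ∑ i, lam i * ⟪S i Δ, d⟫
      ≤ ∑ i, (lam' i - lam i) * b i + (∑ i, lam i * Q.G z ζ i
        + 1 / 2 * (c.κS * c.D₀ ^ 2) * ∑ i, lam i)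
        - 1 / (2 * σ) * (∑ i, lam' i ^ 2 - ∑ i, lam i ^ 2 + ∑ i, (lam' i - lam i) ^ 2) := by
    rw [Finset.mul_sum, ← Finset.sum_sub_distrib, ← Finset.sum_add_distrib,
      ← Finset.sum_add_distrib, ← Finset.sum_sub_distrib, ← Finset.sum_add_distrib,
      Finset.mul_sum, ← Finset.sum_sub_distrib]
    refine Finset.sum_le_sum fun i _ => ?_
    have hbi : b i = Q.G a ζ i + (⟪gG i, e⟫ + (1 / 2 * ⟪S i e, e⟫ - 1 / 2 * ⟪S i d, d⟫)) := rfl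
    rw [← hcompl i, hbi, hSe i, hq i, hge i]
    have := mul_le_mul_of_nonneg_left (hwc i) (hlam0 i)
    rw [hge i] at this
    linarith
  have hnl' : ∑ i, lam' i ^ 2 = ‖lam'‖ ^ 2 := (EuclideanSpace.real_norm_sq_eq lam').symm
  have hnl : ∑ i, lam i ^ 2 = ‖lam‖ ^ 2 := (EuclideanSpace.real_norm_sq_eq lam).symm
  have hndl : ∑ i, (lam' i - lam i) ^ 2 = ‖lam' - lam‖ ^ 2 :=
    (EuclideanSpace.real_norm_sq_eq (lam' - lam)).symm
  have hib : ∑ i, (lam' i - lam i) * b i ≤ ‖lam' - lam‖ * c.γ₁ := by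
    have h := (real_inner_le_norm (lam' - lam) b).trans
      (mul_le_mul_of_nonneg_left hb_norm (norm_nonneg _))
    rwa [inner_eq_sum] at h
  -- The defect uses up half of the Slater margin.
  have hslack : 1 / 2 * (c.κS * c.D₀ ^ 2) * ∑ i, lam i ≤ c.ε₀ / 2 * ‖lam‖ := by
    have h1 := mul_le_mul_of_nonneg_left (sum_le_sqrt_mul_norm lam)
      (by positivity : 0 ≤ 1 / 2 * (c.κS * c.D₀ ^ 2))
    have h2 := mul_le_mul_of_nonneg_right hκε (norm_nonneg lam)
    linarith
  have hF : ⟪gradient (fun y => Q.F y ζ) a, d⟫ ≤ c.κf * c.D₀ :=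
    (real_inner_le_norm _ _).trans (mul_le_mul (hreg.norm_grad_F_le a haO ζ hζ)
      (hreg.diam_le z hz x hx) (norm_nonneg _) hreg.κf_pos.le)
  have hin : ⟪Δ, d⟫ = 1 / 2 * (‖e‖ ^ 2 - ‖Δ‖ ^ 2 - ‖d‖ ^ 2) := by
    rw [hsplit, norm_add_sq_real]; ring
  rw [hnl', hnl, hndl] at hsum
  rw [hin] at hopt
  rw [inner_eq_sum lam]
  -- The square of the multiplier increment cancels the one produced by `hcompl`.
  have hyoung : ‖lam' - lam‖ * c.γ₁ ≤ 1 / (2 * σ) * ‖lam' - lam‖ ^ 2 + σ * c.γ₁ ^ 2 / 2 := by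
    have : 1 / (2 * σ) * ‖lam' - lam‖ ^ 2 + σ * c.γ₁ ^ 2 / 2 - ‖lam' - lam‖ * c.γ₁
        = 1 / (2 * σ) * (‖lam' - lam‖ - σ * c.γ₁) ^ 2 := by field_simp; ring
    have h0 : 0 ≤ 1 / (2 * σ) * (‖lam' - lam‖ - σ * c.γ₁) ^ 2 := by positivity
    linarith
  have hΔ0 : 0 ≤ (α + τ) * ‖Δ‖ ^ 2 := by positivity
  have hfin : 1 / (2 * σ) * (‖lam'‖ ^ 2 - ‖lam‖ ^ 2) + (α + τ) / 2 * (‖d‖ ^ 2 - ‖e‖ ^ 2)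
      ≤ c.κf * c.D₀ + σ * c.γ₁ ^ 2 / 2 + ∑ i, lam i * Q.G z ζ i + c.ε₀ / 2 * ‖lam‖ := by
    linarith
  have := mul_le_mul_of_nonneg_left hfin (by positivity : 0 ≤ 2 * σ)
  have h2 : 2 * σ * (1 / (2 * σ) * (‖lam'‖ ^ 2 - ‖lam‖ ^ 2) + (α + τ) / 2 * (‖d‖ ^ 2 - ‖e‖ ^ 2))
      = ‖lam'‖ ^ 2 - ‖lam‖ ^ 2 + σ * (α + τ) * (‖d‖ ^ 2 - ‖e‖ ^ 2) := by field_simp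
  rw [h2] at this
  linarith

/-- One-step bound on the complementarity violation for the sampled constraints. -/
lemma complementarity_step {Q : Problem n p q} {c : Constants p} (hQ : Q.Standing)
    (hreg : Q.Regular c) {σ α τ : ℝ} (hσ : 0 < σ) (hα : 0 < α) (hτ : 0 ≤ τ)
    {S : Fin p → Vec n →L[ℝ] Vec n} (hSup : ∀ i v, ⟪S i v, v⟫ ≤ -(c.L i * ‖v‖ ^ 2))
    {ζ : Vec q} (hζ : ζ ∈ Q.Ξ) {a x : Vec n} {lam lam' : Vec p}
    (ha : a ∈ Q.X₀) (hlam0 : ∀ i, 0 ≤ lam i)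
    (hmin : IsMinOn (fun y => augLagrangian Q σ (sigmaZero τ S lam) S ζ a lam y
        + α / 2 * ‖y - a‖ ^ 2) Q.X₀ x)
    (hlam : ∀ i, lam' i = max (lam i + σ * quadModel (fun y => Q.G y ζ i) (S i) a x) 0) :
    -⟪lam, Q.G a ζ⟫ ≤ (‖lam‖ ^ 2 - ‖lam'‖ ^ 2) / (2 * σ) + σ * c.νg ^ 2 / 2
      + c.κf ^ 2 / (2 * α) := by
  have haO := hQ.subset_domain ha
  -- The competitor is the current iterate, where each model takes its sampled value.
  have h := hmin ha
  simp only [Set.mem_ofPred_eq, augLagrangian, ← hlam] at h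
  have hself : ∀ (f : Vec n → ℝ) (B : Vec n →L[ℝ] Vec n), quadModel f B a a = f a := by
    intro f B; simp [quadModel]
  simp only [hself, sub_self, norm_zero] at h
  have hnl' : ∑ i, lam' i ^ 2 = ‖lam'‖ ^ 2 := (EuclideanSpace.real_norm_sq_eq lam').symm
  rw [hnl', quadModel, inner_sigmaZero] at h
  have hmax : ∑ i, max (lam i + σ * Q.G a ζ i) 0 ^ 2
      ≤ ‖lam‖ ^ 2 + 2 * σ * ⟪lam, Q.G a ζ⟫ + σ ^ 2 * c.νg ^ 2 := by
    have h1 : ∑ i, max (lam i + σ * Q.G a ζ i) 0 ^ 2 ≤ ‖lam + σ • Q.G a ζ‖ ^ 2 := by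
      rw [EuclideanSpace.real_norm_sq_eq]
      refine Finset.sum_le_sum fun i _ => ?_
      have := max_add_sq_le 0 (lam i + σ * Q.G a ζ i)
      simpa using this
    rw [norm_add_sq_real, inner_smul_right, norm_smul, mul_pow, Real.norm_eq_abs, sq_abs] at h1
    have h2 : ‖Q.G a ζ‖ ^ 2 ≤ c.νg ^ 2 :=
      pow_le_pow_left₀ (norm_nonneg _) (hreg.norm_G_le a haO ζ hζ) 2
    have h3 := mul_le_mul_of_nonneg_left h2 (sq_nonneg σ)
    linarith
  have hneg : ∑ i, lam i * ⟪S i (x - a), x - a⟫ ≤ 0 := by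
    refine Finset.sum_nonpos fun i _ => mul_nonpos_of_nonneg_of_nonpos (hlam0 i) ?_
    have := hSup i (x - a)
    have hL := hreg.L_pos i
    have : 0 ≤ c.L i * ‖x - a‖ ^ 2 := by positivity
    linarith
  have hF : -(c.κf * ‖x - a‖) ≤ ⟪gradient (fun y => Q.F y ζ) a, x - a⟫ := by
    have h1 := neg_le_of_abs_le (abs_real_inner_le_norm (gradient (fun y => Q.F y ζ) a) (x - a))
    have h2 := mul_le_mul_of_nonneg_right (hreg.norm_grad_F_le a haO ζ hζ) (norm_nonneg (x - a))
    linarith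
  have hyoung : c.κf * ‖x - a‖ ≤ α / 2 * ‖x - a‖ ^ 2 + c.κf ^ 2 / (2 * α) := by
    have : α / 2 * ‖x - a‖ ^ 2 + c.κf ^ 2 / (2 * α) - c.κf * ‖x - a‖
        = 1 / (2 * α) * (α * ‖x - a‖ - c.κf) ^ 2 := by field_simp; ring
    have h0 : 0 ≤ 1 / (2 * α) * (α * ‖x - a‖ - c.κf) ^ 2 := by positivity
    linarith
  have hm := mul_le_mul_of_nonneg_left hmax (by positivity : 0 ≤ 1 / (2 * σ))
  have hm' : 1 / (2 * σ) * (‖lam‖ ^ 2 + 2 * σ * ⟪lam, Q.G a ζ⟫ + σ ^ 2 * c.νg ^ 2)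
      = 1 / (2 * σ) * ‖lam‖ ^ 2 + ⟪lam, Q.G a ζ⟫ + σ * c.νg ^ 2 / 2 := by field_simp
  have hd' : (‖lam‖ ^ 2 - ‖lam'‖ ^ 2) / (2 * σ)
      = 1 / (2 * σ) * ‖lam‖ ^ 2 - 1 / (2 * σ) * ‖lam'‖ ^ 2 := by ring
  have hτ0 : 0 ≤ τ * ‖x - a‖ ^ 2 := by positivity
  rw [real_inner_self_eq_norm_sq] at h
  rw [hd']
  linarith

end Drift

/-! ### Jointly measurable versions of the constraint map -/

section Measurability

open scoped ENNReal
open Filter Topology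

variable {n p q : ℕ}

lemma aemeasurable_vec {α : Type*} [MeasurableSpace α] {P : Measure α} {f : α → Vec p}
    (hf : ∀ i, AEMeasurable (fun a => f a i) P) : AEMeasurable f P := by
  have h : AEMeasurable (fun a => (fun i => f a i : Fin p → ℝ)) P := aemeasurable_pi_iff.2 hf
  exact (WithLp.measurable_toLp 2 (Fin p → ℝ)).comp_aemeasurable h

lemma continuousAt_vec {α : Type*} [TopologicalSpace α] {f : α → Vec p} {a : α}
    (hf : ∀ i, ContinuousAt (fun a => f a i) a) : ContinuousAt f a := by
  have h : ContinuousAt (fun a => (fun i => f a i : Fin p → ℝ)) a := continuousAt_pi.2 hf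
  exact (PiLp.continuous_toLp 2 fun _ : Fin p => ℝ).continuousAt.comp h

/-- The constraint map has a jointly measurable version on `X₀`. -/
lemma Problem.Standing.exists_measurable_version {Q : Problem n p q} (hQ : Q.Standing) :
    ∃ H : Vec n → Vec q → Vec p, Measurable (Function.uncurry H) ∧
      ∀ᵐ z ∂Q.P, z ∈ Q.Ξ ∧ ∀ x ∈ Q.X₀, H x z = Q.G x z := by
  classical
  obtain ⟨x₀, hx₀⟩ := hQ.nonempty
  have : Nonempty Q.X₀ := ⟨⟨x₀, hx₀⟩⟩
  let s : ℕ → Q.X₀ := TopologicalSpace.denseSeq Q.X₀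
  have hae : ∀ k, AEMeasurable (Q.G (s k)) Q.P := fun k => aemeasurable_vec fun i =>
    (hQ.integrable_G _ (hQ.subset_domain (s k).2) i).aemeasurable
  have hgood : ∀ᵐ z ∂Q.P, z ∈ Q.Ξ ∧ ∀ k, Q.G (s k) z = (hae k).mk _ z :=
    hQ.supported.and (ae_all_iff.2 fun k => (hae k).ae_eq_mk)
  -- `G` is continuous in `x` and almost everywhere measurable in `z`. Only countably many sections,
  -- at a dense sequence of `X₀`, are corrected, so one measurable null set suffices; the other
  -- sections are pointwise limits, and joint measurability is of Carathéodory type.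
  let N := toMeasurable Q.P {z | ¬(z ∈ Q.Ξ ∧ ∀ k, Q.G (s k) z = (hae k).mk _ z)}
  have hN : MeasurableSet N := measurableSet_toMeasurable _ _
  have hN0 : Q.P N = 0 := by rw [measure_toMeasurable]; exact hgood
  have hNc : ∀ z, z ∉ N → z ∈ Q.Ξ ∧ ∀ k, Q.G (s k) z = (hae k).mk _ z := fun z hz => by
    by_contra h
    exact hz (subset_toMeasurable _ _ h)
  let u : Q.X₀ → Vec q → Vec p := fun x z => if z ∈ N then 0 else Q.G x z
  have hcont : ∀ z, Continuous fun x => u x z := by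
    intro z
    by_cases hz : z ∈ N
    · simpa [u, hz] using continuous_const
    · simp only [u, hz, if_false]
      refine continuous_iff_continuousAt.2 fun x => ?_
      have h : ContinuousAt (fun y => Q.G y z) (x : Vec n) := continuousAt_vec fun i =>
        (hQ.differentiable_G z (hNc z hz).1 x (hQ.subset_domain x.2) i).continuousAt
      exact h.comp continuousAt_subtype_val
  have hmk : ∀ k, Measurable (u (s k)) := by
    intro k
    have : u (s k) = fun z => if z ∈ N then 0 else (hae k).mk _ z := by
      funext z
      by_cases hz : z ∈ N
      · simp [u, hz]
      · simp [u, hz, (hNc z hz).2 k]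
    rw [this]
    exact Measurable.ite hN measurable_const (hae k).measurable_mk
  have hmeas : ∀ x, Measurable (u x) := by
    intro x
    obtain ⟨y, hy, hlim⟩ := mem_closure_iff_seq_limit.1
      (TopologicalSpace.denseRange_denseSeq Q.X₀ x)
    choose k hk using hy
    refine measurable_of_tendsto_metrizable (f := fun j => u (y j)) (fun j => ?_)
      (tendsto_pi_nhds.2 fun z => ((hcont z).tendsto x).comp hlim)
    rw [← hk j]
    exact hmk (k j)
  have hu : Measurable (Function.uncurry u) := measurable_uncurry_of_continuous_of_measurable
    hcont hmeas
  have hmem : ∀ x : Vec n, (if x ∈ Q.X₀ then x else x₀) ∈ Q.X₀ := fun x => by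
    split_ifs with h <;> assumption
  have hproj : Measurable fun x : Vec n => (⟨if x ∈ Q.X₀ then x else x₀, hmem x⟩ : Q.X₀) :=
    (Measurable.ite hQ.isClosed.measurableSet measurable_id measurable_const).subtype_mk
  refine ⟨fun x z => u ⟨if x ∈ Q.X₀ then x else x₀, hmem x⟩ z,
    hu.comp ((hproj.comp measurable_fst).prodMk measurable_snd), ?_⟩
  filter_upwards [compl_mem_ae_iff.2 hN0] with z hz
  refine ⟨(hNc z hz).1, fun x hx => ?_⟩
  have hz' : z ∉ N := hz
  simp [u, hz', hx]

/-- Jointly measurable version of the centred constraint map, with its moment properties. -/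
lemma Problem.LightTail.exists_centered_version {Q : Problem n p q} {c : Constants p} {ρc : ℝ}
    (hC : Q.LightTail ρc) (hQ : Q.Standing) (hreg : Q.Regular c) :
    ∃ D : Vec n → Vec q → Vec p, Measurable (Function.uncurry D) ∧
      (∀ᵐ z ∂Q.P, ∀ x ∈ Q.X₀, D x z = Q.G x z - Q.g x) ∧
      ∀ x i, Integrable (fun z => D x z i) Q.P ∧ ∫ z, D x z i ∂Q.P = 0 ∧
        Integrable (fun z => Real.exp (D x z i ^ 2 / ρc ^ 2)) Q.P ∧
        ∫ z, Real.exp (D x z i ^ 2 / ρc ^ 2) ∂Q.P ≤ Real.exp 1 := by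
  classical
  have := hQ.isProbabilityMeasure
  obtain ⟨H, hH, hHG⟩ := hQ.exists_measurable_version
  let g' : Vec n → Vec p := fun x => WithLp.toLp 2 fun i => ∫ z, H x z i ∂Q.P
  have hcoord : ∀ i, Measurable fun v : Vec p => v i := fun i => by fun_prop
  have hg' : Measurable g' := by
    refine (WithLp.measurable_toLp 2 (Fin p → ℝ)).comp (measurable_pi_iff.2 fun i => ?_)
    have h1 : StronglyMeasurable (Function.uncurry fun x z => H x z i) :=
      ((hcoord i).comp hH).stronglyMeasurable
    exact h1.integral_prod_right.measurable
  have hgg : ∀ x ∈ Q.X₀, g' x = Q.g x := by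
    intro x hx
    ext i
    refine integral_congr_ae ?_
    filter_upwards [hHG] with z hz
    rw [hz.2 x hx]
  have hae : ∀ᵐ z ∂Q.P, ∀ x ∈ Q.X₀,
      (if x ∈ Q.X₀ then H x z - g' x else 0) = Q.G x z - Q.g x := by
    filter_upwards [hHG] with z hz x hx
    rw [if_pos hx, hz.2 x hx, hgg x hx]
  -- The value 0 off `X₀` makes the moment properties hold at every `x`, so they can be integrated
  -- against any law of the iterate.
  refine ⟨fun x z => if x ∈ Q.X₀ then H x z - g' x else 0,
    Measurable.ite (measurable_fst hQ.isClosed.measurableSet)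
      (hH.sub (hg'.comp measurable_fst)) measurable_const, hae, fun x i => ?_⟩
  by_cases hx : x ∈ Q.X₀
  · have hxO := hQ.subset_domain hx
    have he : (fun z => (if x ∈ Q.X₀ then H x z - g' x else 0 : Vec p) i)
        =ᵐ[Q.P] fun z => Q.G x z i - Q.g x i := by
      filter_upwards [hae] with z hz
      rw [hz x hx]; simp
    have hI := hQ.integrable_G x hxO i
    have he2 : (fun z => Real.exp ((if x ∈ Q.X₀ then H x z - g' x else 0 : Vec p) i ^ 2 / ρc ^ 2))
        =ᵐ[Q.P] fun z => Real.exp ((Q.G x z i - Q.g x i) ^ 2 / ρc ^ 2) := by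
      filter_upwards [he] with z hz
      rw [hz]
    refine ⟨(hI.sub (integrable_const _)).congr he.symm, ?_, ?_, ?_⟩
    · rw [integral_congr_ae he, integral_sub hI (integrable_const _)]
      simp [Problem.g]
    · refine Integrable.congr ?_ he2.symm
      refine Integrable.of_bound (C := Real.exp ((c.νg + |Q.g x i|) ^ 2 / ρc ^ 2)) ?_ ?_
      · have := hI.aestronglyMeasurable.aemeasurable
        exact ((((this.sub_const _).pow_const 2).div_const _).exp).aestronglyMeasurable
      · filter_upwards [hQ.supported] with z hz
        rw [Real.norm_eq_abs, Real.abs_exp, Real.exp_le_exp]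
        gcongr ?_ / _
        rw [← sq_abs]
        refine pow_le_pow_left₀ (abs_nonneg _) ((abs_sub _ _).trans ?_) 2
        gcongr
        exact (PiLp.norm_apply_le (Q.G x z) i).trans (hreg.norm_G_le x hxO z hz)
    · rw [integral_congr_ae he2]
      exact hC.exp_moment x hx i
  · simp only [hx, if_false]
    refine ⟨by simp, by simp, by simp, by simp⟩

end Measurability

/-! ### Conditioning on the history -/

section Independence

open scoped ENNReal

variable {q : ℕ} {Ω : Type*} {ξ : ℕ → Ω → Vec q}

lemma history_mono {s t : ℕ} (h : s ≤ t) : history ξ s ≤ history ξ t :=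
  biSup_mono fun _ hj => Finset.Ico_subset_Ico_right h hj

lemma measurable_history_succ {t : ℕ} (ht : 1 ≤ t) : Measurable[history ξ (t + 1)] (ξ t) := by
  have h : MeasurableSpace.comap (ξ t) inferInstance ≤ history ξ (t + 1) :=
    le_iSup₂_of_le (f := fun j (_ : j ∈ Finset.Ico 1 (t + 1)) =>
      MeasurableSpace.comap (ξ j) inferInstance) t (Finset.mem_Ico.2 ⟨ht, t.lt_succ_self⟩) le_rfl
  exact (comap_measurable (ξ t)).mono h le_rfl

variable [MeasurableSpace Ω] {μ : Measure Ω}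

lemma history_le (hξ : ∀ t, 1 ≤ t → Measurable (ξ t)) (t : ℕ) :
    history ξ t ≤ ‹MeasurableSpace Ω› :=
  iSup₂_le fun j hj => (hξ j (Finset.mem_Ico.1 hj).1).comap_le

lemma indepFun_of_measurable_history {α : Type*} [MeasurableSpace α]
    (hξ : ∀ t, 1 ≤ t → Measurable (ξ t)) (hind : iIndepFun (fun k : ℕ => ξ (k + 1)) μ)
    {t : ℕ} (ht : 1 ≤ t) {Y : Ω → α} (hY : Measurable[history ξ t] Y) : IndepFun Y (ξ t) μ := by
  have h := indep_iSup_of_disjoint (S := {k : ℕ | k + 1 < t}) (T := {t - 1})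
    (fun k => (hξ (k + 1) (Nat.le_add_left 1 k)).comap_le) hind (by
      rw [Set.disjoint_singleton_right]; simp; omega)
  rw [IndepFun_iff_Indep]
  refine indep_of_indep_of_le_left (indep_of_indep_of_le_right h ?_) (hY.comap_le.trans ?_)
  · simp [Nat.sub_add_cancel ht]
  · refine iSup₂_le fun j hj => ?_
    obtain ⟨h1, h2⟩ := Finset.mem_Ico.1 hj
    refine le_iSup₂_of_le (j - 1) (by simp; omega) ?_
    rw [Nat.sub_add_cancel h1]

/-- Freezing the past: the joint law is a product, so Tonelli applies. Working with `∫⁻` avoids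
integrability conditions and conditional expectations. -/
lemma lintegral_comp_le_of_indepFun [IsProbabilityMeasure μ] {α β : Type*} [MeasurableSpace α]
    [MeasurableSpace β] {Y : Ω → α} {Z : Ω → β} (hY : Measurable Y) (hZ : Measurable Z)
    (hind : IndepFun Y Z μ) {f : α × β → ℝ≥0∞} (hf : Measurable f) {h : α → ℝ≥0∞}
    (hh : Measurable h) (hle : ∀ y, ∫⁻ z, f (y, z) ∂(μ.map Z) ≤ h y) :
    ∫⁻ ω, f (Y ω, Z ω) ∂μ ≤ ∫⁻ ω, h (Y ω) ∂μ := by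
  have := Measure.isProbabilityMeasure_map (μ := μ) hZ.aemeasurable
  have := Measure.isProbabilityMeasure_map (μ := μ) hY.aemeasurable
  rw [← lintegral_map hf (hY.prodMk hZ),
    (indepFun_iff_map_prod_eq_prod_map_map hY.aemeasurable hZ.aemeasurable).1 hind,
    lintegral_prod _ hf.aemeasurable, ← lintegral_map hh hY]
  exact lintegral_mono hle

end Independence

/-! ### Chernoff bound for the truncated martingale -/

section LightTailSum

open scoped ENNReal

variable {n p q : ℕ}

/-- By Cauchy–Schwarz, `⟨v,d⟩²/(pφρ_c)²` is at most the average of the `d_i²/ρ_c²`; convexity of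
`exp` transfers the coordinatewise moment bounds to the inner product. -/
lemma lintegral_exp_inner_le {β : Type*} [MeasurableSpace β] {P : Measure β}
    [IsProbabilityMeasure P] {d : β → Vec p} {ρc φ u : ℝ} (hρ : 0 < ρc) (hφ : 0 < φ)
    (hp : 0 < p) (hu : 0 ≤ u) (hint : ∀ i, Integrable (fun z => d z i) P)
    (hmean : ∀ i, ∫ z, d z i ∂P = 0)
    (hexp : ∀ i, Integrable (fun z => Real.exp (d z i ^ 2 / ρc ^ 2)) P)
    (hle : ∀ i, ∫ z, Real.exp (d z i ^ 2 / ρc ^ 2) ∂P ≤ Real.exp 1)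
    {v : Vec p} (hv : ‖v‖ ≤ φ) :
    ∫⁻ z, ENNReal.ofReal (Real.exp (u * ⟪v, d z⟫)) ∂P
      ≤ ENNReal.ofReal (Real.exp (3 / 4 * u ^ 2 * (p * φ * ρc) ^ 2)) := by
  have hp0 : (0 : ℝ) < p := Nat.cast_pos.2 hp
  have hp1 : (1 : ℝ) ≤ p := Nat.one_le_cast.2 hp
  set s := p * φ * ρc with hs
  have hs0 : 0 < s := by positivity
  have hX : (fun z => ⟪v, d z⟫) = fun z => ∑ i, v i * d z i := funext fun z => inner_eq_sum _ _
  have hXint : Integrable (fun z => ⟪v, d z⟫) P := by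
    rw [hX]; exact integrable_finsetSum _ fun i _ => (hint i).const_mul _
  have hX0 : ∫ z, ⟪v, d z⟫ ∂P = 0 := by
    rw [hX, integral_finsetSum _ fun i _ => (hint i).const_mul _]
    simp [integral_const_mul, hmean]
  have hpt : ∀ z, Real.exp (⟪v, d z⟫ ^ 2 / s ^ 2)
      ≤ ∑ i, (1 / p : ℝ) * Real.exp (d z i ^ 2 / ρc ^ 2) := by
    intro z
    have h1 : ⟪v, d z⟫ ^ 2 ≤ φ ^ 2 * ∑ i, d z i ^ 2 := by
      rw [← EuclideanSpace.real_norm_sq_eq, ← mul_pow, ← sq_abs]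
      refine pow_le_pow_left₀ (abs_nonneg _) ((abs_real_inner_le_norm _ _).trans ?_) 2
      gcongr
    have h2 : ⟪v, d z⟫ ^ 2 / s ^ 2 ≤ ∑ i, (1 / p : ℝ) * (d z i ^ 2 / ρc ^ 2) := by
      rw [← Finset.mul_sum, ← Finset.sum_div, div_le_iff₀ (by positivity)]
      have h3 : 1 / (p : ℝ) * ((∑ i, d z i ^ 2) / ρc ^ 2) * s ^ 2
          = p * (φ ^ 2 * ∑ i, d z i ^ 2) := by
        rw [hs]; field_simp
      rw [h3]
      refine h1.trans (le_mul_of_one_le_left ?_ hp1)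
      exact mul_nonneg (sq_nonneg _) (Finset.sum_nonneg fun i _ => sq_nonneg _)
    refine (Real.exp_le_exp.2 h2).trans ?_
    have := convexOn_exp.map_sum_le (t := Finset.univ) (w := fun _ : Fin p => (1 / p : ℝ))
      (p := fun i => d z i ^ 2 / ρc ^ 2) (fun i _ => by positivity) (by simp [hp0.ne'])
      (fun i _ => Set.mem_univ _)
    simpa only [smul_eq_mul] using this
  have hdom : Integrable (fun z => ∑ i, (1 / p : ℝ) * Real.exp (d z i ^ 2 / ρc ^ 2)) P :=
    integrable_finsetSum _ fun i _ => (hexp i).const_mul _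
  have hXm := hXint.aestronglyMeasurable.aemeasurable
  have hsq : Integrable (fun z => Real.exp (⟪v, d z⟫ ^ 2 / s ^ 2)) P :=
    hdom.mono' (((hXm.pow_const 2).div_const _).exp).aestronglyMeasurable
      (ae_of_all _ fun z => by rw [Real.norm_eq_abs, Real.abs_exp]; exact hpt z)
  have hsqle : ∫ z, Real.exp (⟪v, d z⟫ ^ 2 / s ^ 2) ∂P ≤ Real.exp 1 := by
    refine (integral_mono hsq hdom hpt).trans ?_
    rw [integral_finsetSum _ fun i _ => (hexp i).const_mul _]
    calc ∑ i, ∫ z, (1 / p : ℝ) * Real.exp (d z i ^ 2 / ρc ^ 2) ∂P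
        ≤ ∑ _i : Fin p, (1 / p : ℝ) * Real.exp 1 := Finset.sum_le_sum fun i _ => by
          rw [integral_const_mul]
          exact mul_le_mul_of_nonneg_left (hle i) (by positivity)
      _ = Real.exp 1 := by simp; field_simp
  have hexpu : Integrable (fun z => Real.exp (u * ⟪v, d z⟫)) P := by
    refine (hsq.const_mul (Real.exp ((u * s) ^ 2 / 4))).mono'
      ((hXm.const_mul u).exp).aestronglyMeasurable (ae_of_all _ fun z => ?_)
    rw [Real.norm_eq_abs, Real.abs_exp, ← Real.exp_add, Real.exp_le_exp, ← div_pow]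
    -- Integrability follows from `uX ≤ (us)²/4 + X²/s²`.
    have : ⟪v, d z⟫ = s * (⟪v, d z⟫ / s) := by field_simp
    nlinarith [sq_nonneg (u * s / 2 - ⟪v, d z⟫ / s)]
  rw [← ofReal_integral_eq_lintegral_ofReal hexpu (ae_of_all _ fun z => (Real.exp_pos _).le)]
  exact ENNReal.ofReal_le_ofReal
    (integral_exp_mul_le_of_exp_sq hs0 hu hXint hX0 hsq hsqle)

/-- `v` if `‖v‖ ≤ φ`, and `0` otherwise. -/
noncomputable def truncate (φ : ℝ) (v : Vec p) : Vec p :=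
  open scoped Classical in if ‖v‖ ≤ φ then v else 0

lemma norm_truncate_le {φ : ℝ} (hφ : 0 ≤ φ) (v : Vec p) : ‖truncate φ v‖ ≤ φ := by
  unfold truncate
  split_ifs with h
  · exact h
  · simpa using hφ

lemma measurable_truncate (φ : ℝ) : Measurable (truncate φ : Vec p → Vec p) :=
  Measurable.ite (measurableSet_le measurable_norm measurable_const) measurable_id measurable_const

lemma _root_.Measurable.inner_truncate {δ : Type*} {m : MeasurableSpace δ}
    {D : Vec n → Vec q → Vec p} (hD : Measurable (Function.uncurry D)) (φ : ℝ)
    {x : δ → Vec n} {l : δ → Vec p} {z : δ → Vec q}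
    (hx : Measurable x) (hl : Measurable l) (hz : Measurable z) :
    Measurable fun a => ⟪truncate φ (l a), D (x a) (z a)⟫ := by
  have h1 : Measurable fun a => truncate φ (l a) := (measurable_truncate φ).comp hl
  have h2 : Measurable fun a => D (x a) (z a) := hD.comp (hx.prodMk hz)
  exact h1.inner h2

variable {Ω : Type*} {ξ : ℕ → Ω → Vec q}

/-- Partial sums of `⟪λ^t, D(x^t, ξ_t)⟫` over the times at which `‖λ^t‖ ≤ φ`. -/
noncomputable def truncSum (φ : ℝ) (D : Vec n → Vec q → Vec p) (ξ : ℕ → Ω → Vec q)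
    (x : ℕ → Ω → Vec n) (lam : ℕ → Ω → Vec p) (t : ℕ) (ω : Ω) : ℝ :=
  ∑ j ∈ Finset.Ico 1 t, ⟪truncate φ (lam j ω), D (x j ω) (ξ j ω)⟫

lemma measurable_truncSum {D : Vec n → Vec q → Vec p} (hD : Measurable (Function.uncurry D))
    {φ : ℝ} {T : ℕ} {x : ℕ → Ω → Vec n} {lam : ℕ → Ω → Vec p}
    (hx : ∀ t ∈ Finset.Icc 1 (T + 1), Measurable[history ξ t] (x t))
    (hlam : ∀ t ∈ Finset.Icc 1 (T + 1), Measurable[history ξ t] (lam t))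
    {t : ℕ} (ht : t ≤ T + 1) : Measurable[history ξ t] (truncSum φ D ξ x lam t) := by
  unfold truncSum
  refine Finset.measurable_fun_sum (m := history ξ t) _ fun j hj => ?_
  obtain ⟨h1, h2⟩ := Finset.mem_Ico.1 hj
  have hm : j ∈ Finset.Icc 1 (T + 1) := Finset.mem_Icc.2 ⟨h1, by omega⟩
  have hxj := (hx j hm).mono (history_mono h2.le) le_rfl
  have hlj := (hlam j hm).mono (history_mono h2.le) le_rfl
  have hξj := (measurable_history_succ (ξ := ξ) h1).mono (history_mono (Nat.succ_le_of_lt h2)) le_rfl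
  exact hD.inner_truncate φ hxj hlj hξj

variable [MeasurableSpace Ω] {μ : Measure Ω} [IsProbabilityMeasure μ] {P : Measure (Vec q)}

/-- Truncation makes the one-step bound valid for every past, so each step multiplies the moment by
at most `exp K`; no stopping time is needed. -/
lemma lintegral_exp_truncSum_le (hξ : ∀ t, 1 ≤ t → Measurable (ξ t))
    (hlaw : ∀ t, 1 ≤ t → μ.map (ξ t) = P) (hind : iIndepFun (fun k : ℕ => ξ (k + 1)) μ)
    {D : Vec n → Vec q → Vec p} (hD : Measurable (Function.uncurry D)) {ρc φ u : ℝ}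
    (hρ : 0 < ρc) (hφ : 0 < φ) (hp : 0 < p) (hu : 0 ≤ u)
    (hDP : ∀ x i, Integrable (fun z => D x z i) P ∧ ∫ z, D x z i ∂P = 0 ∧
        Integrable (fun z => Real.exp (D x z i ^ 2 / ρc ^ 2)) P ∧
        ∫ z, Real.exp (D x z i ^ 2 / ρc ^ 2) ∂P ≤ Real.exp 1)
    {T : ℕ} {x : ℕ → Ω → Vec n} {lam : ℕ → Ω → Vec p}
    (hx : ∀ t ∈ Finset.Icc 1 (T + 1), Measurable[history ξ t] (x t))
    (hlam : ∀ t ∈ Finset.Icc 1 (T + 1), Measurable[history ξ t] (lam t))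
    (t : ℕ) (ht : t ≤ T) :
    ∫⁻ ω, ENNReal.ofReal (Real.exp (u * truncSum φ D ξ x lam (t + 1) ω)) ∂μ
      ≤ ENNReal.ofReal (Real.exp (t * (3 / 4 * u ^ 2 * (p * φ * ρc) ^ 2))) := by
  set K := 3 / 4 * u ^ 2 * (p * φ * ρc) ^ 2 with hK
  induction t with
  | zero => simp [truncSum]
  | succ t ih =>
    have ht1 : 1 ≤ t + 1 := Nat.le_add_left 1 t
    have hm : t + 1 ∈ Finset.Icc 1 (T + 1) := Finset.mem_Icc.2 ⟨ht1, by omega⟩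
    have hYh : Measurable[history ξ (t + 1)] fun ω =>
        (truncSum φ D ξ x lam (t + 1) ω, (x (t + 1) ω, lam (t + 1) ω)) :=
      (measurable_truncSum hD hx hlam (by omega)).prodMk ((hx _ hm).prodMk (hlam _ hm))
    have hP : IsProbabilityMeasure P := by
      rw [← hlaw 1 le_rfl]; exact Measure.isProbabilityMeasure_map (hξ 1 le_rfl).aemeasurable
    have key := lintegral_comp_le_of_indepFun (μ := μ)
      (hYh.mono (history_le hξ (t + 1)) le_rfl) (hξ (t + 1) ht1)
      (indepFun_of_measurable_history hξ hind ht1 hYh)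
      (f := fun y : (ℝ × Vec n × Vec p) × Vec q => ENNReal.ofReal (Real.exp (u * y.1.1))
        * ENNReal.ofReal (Real.exp (u * ⟪truncate φ y.1.2.2, D y.1.2.1 y.2⟫)))
      (h := fun y => ENNReal.ofReal (Real.exp (u * y.1)) * ENNReal.ofReal (Real.exp K))
      (by
        have h1 : Measurable fun y : (ℝ × Vec n × Vec p) × Vec q =>
            ⟪truncate φ y.1.2.2, D y.1.2.1 y.2⟫ := hD.inner_truncate φ
          (measurable_fst.comp (measurable_snd.comp measurable_fst))
          (measurable_snd.comp (measurable_snd.comp measurable_fst)) measurable_snd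
        have h2 : Measurable fun y : (ℝ × Vec n × Vec p) × Vec q => y.1.1 :=
          measurable_fst.comp measurable_fst
        exact ((h2.const_mul u).exp.ennreal_ofReal).mul (h1.const_mul u).exp.ennreal_ofReal)
      (((measurable_fst.const_mul u).exp.ennreal_ofReal).mul_const _)
      (fun y => by
        rw [hlaw (t + 1) ht1]
        simp only
        rw [lintegral_const_mul' _ _ ENNReal.ofReal_ne_top]
        gcongr
        exact lintegral_exp_inner_le hρ hφ hp hu (fun i => (hDP y.2.1 i).1)
          (fun i => (hDP y.2.1 i).2.1) (fun i => (hDP y.2.1 i).2.2.1)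
          (fun i => (hDP y.2.1 i).2.2.2) (norm_truncate_le hφ.le _))
    have hstep : ∀ ω, truncSum φ D ξ x lam (t + 1 + 1) ω = truncSum φ D ξ x lam (t + 1) ω
        + ⟪truncate φ (lam (t + 1) ω), D (x (t + 1) ω) (ξ (t + 1) ω)⟫ := fun ω =>
      Finset.sum_Ico_succ_top ht1 _
    simp only [hstep, mul_add, Real.exp_add, ENNReal.ofReal_mul (Real.exp_pos _).le]
    refine key.trans ?_
    rw [lintegral_mul_const' _ _ ENNReal.ofReal_ne_top]
    refine (mul_le_mul_left (ih (by omega)) _).trans_eq ?_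
    rw [← ENNReal.ofReal_mul (Real.exp_pos _).le, ← Real.exp_add]
    push_cast
    ring_nf

lemma measure_truncSum_ge_le (hξ : ∀ t, 1 ≤ t → Measurable (ξ t))
    (hlaw : ∀ t, 1 ≤ t → μ.map (ξ t) = P) (hind : iIndepFun (fun k : ℕ => ξ (k + 1)) μ)
    {D : Vec n → Vec q → Vec p} (hD : Measurable (Function.uncurry D)) {ρc φ η : ℝ}
    (hρ : 0 < ρc) (hφ : 0 < φ) (hp : 0 < p) (hη : 0 ≤ η)
    (hDP : ∀ x i, Integrable (fun z => D x z i) P ∧ ∫ z, D x z i ∂P = 0 ∧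
        Integrable (fun z => Real.exp (D x z i ^ 2 / ρc ^ 2)) P ∧
        ∫ z, Real.exp (D x z i ^ 2 / ρc ^ 2) ∂P ≤ Real.exp 1)
    {T : ℕ} (hT : 0 < T) {x : ℕ → Ω → Vec n} {lam : ℕ → Ω → Vec p}
    (hx : ∀ t ∈ Finset.Icc 1 (T + 1), Measurable[history ξ t] (x t))
    (hlam : ∀ t ∈ Finset.Icc 1 (T + 1), Measurable[history ξ t] (lam t)) :
    μ.real {ω | η * (p * φ * ρc) * √(T : ℝ) < truncSum φ D ξ x lam (T + 1) ω}
      ≤ Real.exp (-η ^ 2 / 3) := by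
  have hp0 : (0 : ℝ) < p := Nat.cast_pos.2 hp
  have hT0 : (0 : ℝ) < T := Nat.cast_pos.2 hT
  set s := p * φ * ρc with hs
  have hs0 : 0 < s := by positivity
  have hr : 0 < √(T : ℝ) := Real.sqrt_pos.2 hT0
  have hrr : √(T : ℝ) ^ 2 = T := Real.sq_sqrt hT0.le
  -- The minimizer of `(3/4)T u²s² - uηs√T`, whose minimum is `-η²/3`.
  set u := 2 * η / (3 * s * √(T : ℝ)) with hu
  have hu0 : 0 ≤ u := by positivity
  have h1 := lintegral_exp_truncSum_le hξ hlaw hind hD hρ hφ hp hu0 hDP hx hlam T le_rfl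
  rw [← hs] at h1
  have h2 : μ {ω | η * s * √(T : ℝ) < truncSum φ D ξ x lam (T + 1) ω}
      ≤ ENNReal.ofReal (Real.exp (-η ^ 2 / 3)) := by
    have hmeas : Measurable (truncSum φ D ξ x lam (T + 1)) :=
      (measurable_truncSum hD hx hlam le_rfl).mono (history_le hξ _) le_rfl
    have hM := mul_meas_ge_le_lintegral₀ (μ := μ)
      ((hmeas.const_mul u).exp.ennreal_ofReal.aemeasurable)
      (ENNReal.ofReal (Real.exp (u * (η * s * √(T : ℝ)))))
    have hsub : {ω | η * s * √(T : ℝ) < truncSum φ D ξ x lam (T + 1) ω}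
        ⊆ {ω | ENNReal.ofReal (Real.exp (u * (η * s * √(T : ℝ))))
          ≤ ENNReal.ofReal (Real.exp (u * truncSum φ D ξ x lam (T + 1) ω))} := fun ω hω =>
      ENNReal.ofReal_le_ofReal (Real.exp_le_exp.2 (mul_le_mul_of_nonneg_left
        (le_of_lt hω) hu0))
    have hpos : ENNReal.ofReal (Real.exp (u * (η * s * √(T : ℝ)))) ≠ 0 := by
      simp [Real.exp_pos]
    refine (measure_mono hsub).trans
      ((ENNReal.le_div_iff_mul_le (Or.inl hpos) (Or.inl ENNReal.ofReal_ne_top)).2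
        ((mul_comm _ _).trans_le (hM.trans h1)) |>.trans_eq ?_)
    rw [← ENNReal.ofReal_div_of_pos (Real.exp_pos _), ← Real.exp_sub]
    congr 2
    have hu1 : u * (η * s * √(T : ℝ)) = 2 / 3 * η ^ 2 := by rw [hu]; field_simp
    have hu2 : T * (3 / 4 * u ^ 2 * s ^ 2) = 1 / 3 * η ^ 2 := by
      have h3 : u * s * √(T : ℝ) = 2 / 3 * η := by rw [hu]; field_simp
      calc T * (3 / 4 * u ^ 2 * s ^ 2) = 3 / 4 * (u * s * √(T : ℝ)) ^ 2 := by
            rw [mul_pow _ (√(T : ℝ)), hrr]; ring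
        _ = 1 / 3 * η ^ 2 := by rw [h3]; ring
    rw [hu1, hu2]; ring
  exact ENNReal.toReal_le_of_le_ofReal (Real.exp_pos _).le h2

end LightTailSum

/-! ### Exponential drift and tail of the multipliers -/

section MultiplierTail

open scoped ENNReal

variable {n p q : ℕ}

/-- Exponential drift of `√(‖λ‖² + …)` beyond the threshold `4A/ε + 2√C`. -/
lemma lintegral_exp_drift_le {β : Type*} [MeasurableSpace β] {P : Measure β}
    [IsProbabilityMeasure P] {h : β → Vec p} {A C ε ν σ : ℝ} (hA : σ * ν ^ 2 / 2 ≤ A) (hC : 0 ≤ C)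
    (hε : 0 < ε) (hεν : ε ≤ ν) (hσ : 0 < σ) (hh : Measurable h) (hhν : ∀ᵐ z ∂P, ‖h z‖ ≤ ν)
    (hhε : ∀ i, ∫ z, h z i ∂P ≤ -ε) {l : Vec p} (hl : ∀ i, 0 ≤ l i) {U : ℝ} (hlU : ‖l‖ ≤ U)
    (hUC : U ^ 2 ≤ ‖l‖ ^ 2 + C) :
    ∫⁻ z, ENNReal.ofReal (Real.exp (ε / (4 * σ * ν ^ 2) *
        √(U ^ 2 + 2 * σ * (A + ⟪l, h z⟫ + ε / 2 * ‖l‖)))) ∂P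
      ≤ ENNReal.ofReal (Real.exp (ε / (4 * σ * ν ^ 2) * U)) + ENNReal.ofReal
        (Real.exp (ε / (4 * σ * ν ^ 2) * (4 * A / ε + 2 * √C + 2 * σ * ν))) := by
  have hν : 0 < ν := hε.trans_le hεν
  have hA0 : 0 < A := lt_of_lt_of_le (by positivity) hA
  set r := ε / (4 * σ * ν ^ 2) with hr
  have hr0 : 0 < r := by positivity
  -- The rate `r` is chosen so that the Hoeffding term `ν²(rσ)²/2` equals `rσε/8`, exactly the drift
  -- available above the threshold.
  have hrν : r * σ * ν ^ 2 = ε / 4 := by rw [hr]; field_simp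
  set θ := 4 * A / ε + 2 * √C with hθ
  have hθA : 4 * A / ε ≤ θ := by rw [hθ]; linarith [Real.sqrt_nonneg C]
  have hθC : 2 * √C ≤ θ := by rw [hθ]; linarith [show 0 < 4 * A / ε by positivity]
  have hθA' : A ≤ ε / 4 * θ := by rw [div_le_iff₀ hε] at hθA; linarith
  have hθ0 : 0 < θ := lt_of_lt_of_le (by positivity) hθA
  have hl0 := norm_nonneg l
  have hU0 : 0 ≤ U := hl0.trans hlU
  -- Below `θ`, one step reaches at most `θ + 2σν`, whence the additive constant. Above `θ`, the
  -- exponential moment does not increase.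
  rcases le_or_gt U θ with hU | hU
  · calc ∫⁻ z, ENNReal.ofReal (Real.exp (r * √(U ^ 2 + 2 * σ * (A + ⟪l, h z⟫ + ε / 2 * ‖l‖)))) ∂P
        ≤ ∫⁻ _z, ENNReal.ofReal (Real.exp (r * (θ + 2 * σ * ν))) ∂P := by
          refine lintegral_mono_ae ?_
          filter_upwards [hhν] with z hz
          refine ENNReal.ofReal_le_ofReal (Real.exp_le_exp.2
            (mul_le_mul_of_nonneg_left (Real.sqrt_le_iff.2 ⟨by positivity, ?_⟩) hr0.le))
          have h1 : ⟪l, h z⟫ ≤ θ * ν := (real_inner_le_norm _ _).trans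
            (mul_le_mul (hlU.trans hU) hz (norm_nonneg _) hθ0.le)
          have h2 : ε / 2 * ‖l‖ ≤ ε / 2 * θ := by gcongr; exact hlU.trans hU
          have h3 : ε * θ ≤ ν * θ := by gcongr
          have h4 : A + ⟪l, h z⟫ + ε / 2 * ‖l‖ ≤ 2 * (ν * θ) := by linarith [mul_pos hν hθ0]
          have h5 := mul_le_mul_of_nonneg_left h4 (by positivity : 0 ≤ 2 * σ)
          have h6 : U ^ 2 ≤ θ ^ 2 := pow_le_pow_left₀ hU0 hU 2
          have h7 := sq_nonneg (2 * σ * ν)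
          linarith
      _ = ENNReal.ofReal (Real.exp (r * (θ + 2 * σ * ν))) := by simp
      _ ≤ _ := le_add_self
  · refine le_add_right ?_
    have hUpos : 0 < U := hθ0.trans hU
    set v : Vec p := U⁻¹ • l with hv
    have hvn : ‖v‖ = ‖l‖ / U := by
      rw [hv, norm_smul, norm_inv, Real.norm_of_nonneg hU0]; field_simp
    have hv1 : ‖v‖ ≤ 1 := by rw [hvn, div_le_one hUpos]; exact hlU
    -- `U > 2√C` gives `‖v‖² ≥ 3/4`, and `‖v‖ ≤ 1` upgrades this to `‖v‖ ≥ 3/4`.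
    have hv34 : 3 / 4 ≤ ‖v‖ := by
      have h1 : C ≤ U ^ 2 / 4 := by
        have : (2 * √C) ^ 2 ≤ U ^ 2 := pow_le_pow_left₀ (by positivity) (hθC.trans hU.le) 2
        rw [mul_pow, Real.sq_sqrt hC] at this
        linarith
      have h2 : 3 / 4 ≤ ‖v‖ ^ 2 := by
        rw [hvn, div_pow, le_div_iff₀ (by positivity)]; linarith
      nlinarith [norm_nonneg v]
    have hX : ∀ᵐ z ∂P, ⟪v, h z⟫ ∈ Set.Icc (-ν) ν := by
      filter_upwards [hhν] with z hz
      have h1 : |⟪v, h z⟫| ≤ ν := (abs_real_inner_le_norm _ _).trans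
        ((mul_le_mul hv1 hz (norm_nonneg _) zero_le_one).trans_eq (one_mul ν))
      exact abs_le.1 h1
    have hXm : Measurable fun z => ⟪v, h z⟫ := measurable_const.inner hh
    have hsub := hasSubgaussianMGF_of_mem_Icc hXm.aemeasurable hX
    have hc : (((‖ν - -ν‖₊ / 2) ^ 2 : NNReal) : ℝ) = ν ^ 2 := by
      push_cast
      rw [Real.norm_of_nonneg (by linarith)]
      ring
    -- Nonnegative coordinates turn the coordinatewise Slater bound into one with `‖v‖`, since `‖v‖
    -- ≤ ∑ v_i`.
    have hmean : ∫ z, ⟪v, h z⟫ ∂P ≤ -(ε * ‖v‖) := by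
      have hi : ∀ i, Integrable (fun z => h z i) P := fun i => by
        refine Integrable.of_bound (C := ν)
          (by fun_prop : Measurable fun z => h z i).aestronglyMeasurable ?_
        filter_upwards [hhν] with z hz using (PiLp.norm_apply_le (h z) i).trans hz
      have hv0 : ∀ i, 0 ≤ v i := fun i => by
        rw [hv]; exact mul_nonneg (inv_nonneg.2 hU0) (hl i)
      simp only [inner_eq_sum]
      rw [integral_finsetSum _ fun i _ => (hi i).const_mul _]
      calc ∑ i, ∫ z, v i * h z i ∂P ≤ ∑ i, v i * -ε := Finset.sum_le_sum fun i _ => by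
            rw [integral_const_mul]; exact mul_le_mul_of_nonneg_left (hhε i) (hv0 i)
        _ = -(ε * ∑ i, v i) := by rw [← Finset.sum_mul]; ring
        _ ≤ _ := neg_le_neg (mul_le_mul_of_nonneg_left (norm_le_sum_of_nonneg hv0) hε.le)
    set m := ∫ z, ⟪v, h z⟫ ∂P with hm
    set B := r * U + r * σ * ((A + ε / 2 * ‖l‖) / U) + r * σ * m with hB
    have hpt : ∀ᵐ z ∂P, ENNReal.ofReal (Real.exp (r *
        √(U ^ 2 + 2 * σ * (A + ⟪l, h z⟫ + ε / 2 * ‖l‖))))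
        ≤ ENNReal.ofReal (Real.exp B * Real.exp (r * σ * (⟪v, h z⟫ - m))) := by
      filter_upwards [hX] with z hz
      rw [← Real.exp_add]
      refine ENNReal.ofReal_le_ofReal (Real.exp_le_exp.2 ?_)
      have hin : ⟪l, h z⟫ = U * ⟪v, h z⟫ := by
        rw [hv, inner_smul_left, RCLike.conj_to_real]; field_simp
      set b := (A + ε / 2 * ‖l‖) / U + ⟪v, h z⟫ with hb
      have hbU : A + ⟪l, h z⟫ + ε / 2 * ‖l‖ = U * b := by rw [hb, hin]; field_simp; ring
      have hσν : σ * ν ≤ θ := by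
        refine le_trans ?_ hθA
        rw [le_div_iff₀ hε]
        have := mul_le_mul_of_nonneg_left hεν (by positivity : 0 ≤ σ * ν)
        nlinarith [mul_pos hσ (mul_pos hν hν)]
      have hb0 : -ν ≤ b := by
        have : 0 ≤ (A + ε / 2 * ‖l‖) / U := by positivity
        linarith [hz.1]
      -- `√(U² + 2σUb) ≤ U + σb` needs a nonnegative right side, which `σν ≤ θ < U` ensures.
      have hsqrt : √(U ^ 2 + 2 * σ * (A + ⟪l, h z⟫ + ε / 2 * ‖l‖)) ≤ U + σ * b := by
        rw [hbU]
        refine Real.sqrt_le_iff.2 ⟨?_, by nlinarith [sq_nonneg (σ * b)]⟩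
        have := mul_le_mul_of_nonneg_left hb0 hσ.le
        linarith
      have := mul_le_mul_of_nonneg_left hsqrt hr0.le
      rw [hb] at this
      rw [hB]
      linarith
    have hBle : B + ν ^ 2 * (r * σ) ^ 2 / 2 ≤ r * U := by
      have h1 : A / U ≤ ε / 4 := by
        rw [div_le_iff₀ hUpos]
        exact hθA'.trans (by gcongr)
      have h2 : (A + ε / 2 * ‖l‖) / U = A / U + ε / 2 * ‖v‖ := by rw [hvn]; ring
      have h3 : ν ^ 2 * (r * σ) ^ 2 / 2 = r * σ * (ε / 8) := by
        rw [show ε / 8 = (ε / 4) / 2 by ring, ← hrν]; ring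
      -- The mean drift is at most `ε/4 + (ε/2)‖v‖ - ε‖v‖ ≤ -ε/8`.
      have h4 : (A + ε / 2 * ‖l‖) / U + m + ε / 8 ≤ 0 := by
        have := mul_le_mul_of_nonneg_left hv34 hε.le
        rw [h2]; linarith
      have h5 := mul_nonpos_of_nonneg_of_nonpos (by positivity : 0 ≤ r * σ) h4
      rw [hB, h3]; linarith
    refine (lintegral_mono_ae hpt).trans ?_
    have hint := hsub.integrable_exp_mul (r * σ)
    have hmgf := hsub.mgf_le (r * σ)
    rw [hc] at hmgf
    rw [← ofReal_integral_eq_lintegral_ofReal (hint.const_mul _)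
      (ae_of_all _ fun z => by positivity)]
    refine ENNReal.ofReal_le_ofReal ?_
    rw [integral_const_mul]
    calc Real.exp B * ∫ z, Real.exp (r * σ * (⟪v, h z⟫ - m)) ∂P
        ≤ Real.exp B * Real.exp (ν ^ 2 * (r * σ) ^ 2 / 2) :=
          mul_le_mul_of_nonneg_left hmgf (Real.exp_pos _).le
      _ = Real.exp (B + ν ^ 2 * (r * σ) ^ 2 / 2) := (Real.exp_add _ _).symm
      _ ≤ Real.exp (r * U) := Real.exp_le_exp.2 hBle

/-- Square root of the Lyapunov function `‖λ‖² + κ‖x̂ - x‖²`. -/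
noncomputable def lyapunov (κ : ℝ) (xhat x : Vec n) (l : Vec p) : ℝ :=
  √(‖l‖ ^ 2 + κ * ‖xhat - x‖ ^ 2)

lemma measurable_lyapunov (κ : ℝ) (xhat : Vec n) :
    Measurable fun y : Vec n × Vec p => lyapunov κ xhat y.1 y.2 := by
  unfold lyapunov
  exact Continuous.measurable (by fun_prop)

variable {Ω : Type*} [MeasurableSpace Ω] {μ : Measure Ω} [IsProbabilityMeasure μ]
  {ξ : ℕ → Ω → Vec q} {P : Measure (Vec q)}

/-- Each step adds at most one `exp(rR)`, and the start contributes one because `λ^1 = 0` and `√C ≤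
R`. -/
lemma lintegral_exp_lyapunov_le (hξ : ∀ t, 1 ≤ t → Measurable (ξ t))
    (hlaw : ∀ t, 1 ≤ t → μ.map (ξ t) = P) (hind : iIndepFun (fun k : ℕ => ξ (k + 1)) μ)
    {h : Vec q → Vec p} {A C ε ν σ κ : ℝ} {xhat : Vec n} (hA : σ * ν ^ 2 / 2 ≤ A) (hC : 0 ≤ C)
    (hκ : 0 ≤ κ)
    (hε : 0 < ε) (hεν : ε ≤ ν) (hσ : 0 < σ) (hh : Measurable h) (hhν : ∀ᵐ z ∂P, ‖h z‖ ≤ ν)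
    (hhε : ∀ i, ∫ z, h z i ∂P ≤ -ε)
    {T : ℕ} {x : ℕ → Ω → Vec n} {lam : ℕ → Ω → Vec p}
    (hx : ∀ t ∈ Finset.Icc 1 (T + 1), Measurable[history ξ t] (x t))
    (hlam : ∀ t ∈ Finset.Icc 1 (T + 1), Measurable[history ξ t] (lam t))
    (hstart : ∀ᵐ ω ∂μ, lam 1 ω = 0)
    (hgood : ∀ᵐ ω ∂μ, ∀ t ∈ Finset.Icc 1 (T + 1),
      (∀ i, 0 ≤ lam t ω i) ∧ κ * ‖xhat - x t ω‖ ^ 2 ≤ C)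
    (hdrift : ∀ᵐ ω ∂μ, ∀ t ∈ Finset.Icc 1 T,
      ‖lam (t + 1) ω‖ ^ 2 + κ * ‖xhat - x (t + 1) ω‖ ^ 2
        ≤ ‖lam t ω‖ ^ 2 + κ * ‖xhat - x t ω‖ ^ 2
          + 2 * σ * (A + ⟪lam t ω, h (ξ t ω)⟫ + ε / 2 * ‖lam t ω‖))
    (t : ℕ) (ht : t ≤ T) :
    ∫⁻ ω, ENNReal.ofReal (Real.exp (ε / (4 * σ * ν ^ 2) *
        lyapunov κ xhat (x (t + 1) ω) (lam (t + 1) ω))) ∂μ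
      ≤ (t + 1) * ENNReal.ofReal
        (Real.exp (ε / (4 * σ * ν ^ 2) * (4 * A / ε + 2 * √C + 2 * σ * ν))) := by
  classical
  have hν : 0 < ν := hε.trans_le hεν
  have hA0 : 0 < A := lt_of_lt_of_le (by positivity) hA
  set r := ε / (4 * σ * ν ^ 2) with hr
  have hr0 : 0 < r := by positivity
  set R := 4 * A / ε + 2 * √C + 2 * σ * ν with hR
  have hCR : √C ≤ R := by
    have : 0 < 4 * A / ε := by positivity
    have : 0 < 2 * σ * ν := by positivity
    linarith [Real.sqrt_nonneg C]
  induction t with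
  | zero =>
    have h1 : ∫⁻ ω, ENNReal.ofReal (Real.exp (r * lyapunov κ xhat (x (0 + 1) ω) (lam (0 + 1) ω))) ∂μ
        ≤ ∫⁻ _ω, ENNReal.ofReal (Real.exp (r * R)) ∂μ := by
      refine lintegral_mono_ae ?_
      filter_upwards [hstart, hgood] with ω h0 hg
      refine ENNReal.ofReal_le_ofReal (Real.exp_le_exp.2 (mul_le_mul_of_nonneg_left ?_ hr0.le))
      refine le_trans (Real.sqrt_le_sqrt ?_) hCR
      simpa [h0] using (hg 1 (Finset.mem_Icc.2 ⟨le_rfl, by omega⟩)).2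
    simpa using h1
  | succ t ih =>
    have ht1 : 1 ≤ t + 1 := Nat.le_add_left 1 t
    have hm : t + 1 ∈ Finset.Icc 1 (T + 1) := Finset.mem_Icc.2 ⟨ht1, by omega⟩
    have hm' : t + 1 ∈ Finset.Icc 1 T := Finset.mem_Icc.2 ⟨ht1, ht⟩
    have hYh : Measurable[history ξ (t + 1)] fun ω => (x (t + 1) ω, lam (t + 1) ω) :=
      (hx _ hm).prodMk (hlam _ hm)
    have hY := hYh.mono (history_le hξ (t + 1)) le_rfl
    have hP : IsProbabilityMeasure P := by
      rw [← hlaw 1 le_rfl]; exact Measure.isProbabilityMeasure_map (hξ 1 le_rfl).aemeasurable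
    let K : Set (Vec n × Vec p) := {y | (∀ i, 0 ≤ y.2 i) ∧ κ * ‖xhat - y.1‖ ^ 2 ≤ C}
    have hK : MeasurableSet K := by
      have h1 : MeasurableSet {y : Vec n × Vec p | ∀ i, 0 ≤ y.2 i} := by
        rw [Set.ofPred_forall]
        exact MeasurableSet.iInter fun i => measurableSet_le measurable_const (by fun_prop)
      have h2 : MeasurableSet {y : Vec n × Vec p | κ * ‖xhat - y.1‖ ^ 2 ≤ C} :=
        measurableSet_le (by fun_prop) measurable_const
      exact h1.inter h2
    -- Setting `F` to zero off the admissible states `K` makes the frozen-past bound hold at every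
    -- state, while almost every path stays in `K`.
    let F : (Vec n × Vec p) × Vec q → ℝ≥0∞ := fun y => if y.1 ∈ K then
      ENNReal.ofReal (Real.exp (r * √(lyapunov κ xhat y.1.1 y.1.2 ^ 2
        + 2 * σ * (A + ⟪y.1.2, h y.2⟫ + ε / 2 * ‖y.1.2‖)))) else 0
    have hF : Measurable F := by
      refine Measurable.ite (measurable_fst hK) ?_ measurable_const
      have h1 : Measurable fun y : (Vec n × Vec p) × Vec q => lyapunov κ xhat y.1.1 y.1.2 :=
        (measurable_lyapunov κ xhat).comp measurable_fst
      have h2 : Measurable fun y : (Vec n × Vec p) × Vec q => y.1.2 :=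
        measurable_snd.comp measurable_fst
      have h3 : Measurable fun y : (Vec n × Vec p) × Vec q => ⟪y.1.2, h y.2⟫ :=
        h2.inner (hh.comp measurable_snd)
      exact ((((h1.pow_const 2).add (((measurable_const.add h3).add
        (h2.norm.const_mul _)).const_mul _)).sqrt.const_mul r).exp).ennreal_ofReal
    have key := lintegral_comp_le_of_indepFun (μ := μ) hY (hξ (t + 1) ht1)
      (indepFun_of_measurable_history hξ hind ht1 hYh) hF
      (h := fun y => ENNReal.ofReal (Real.exp (r * lyapunov κ xhat y.1 y.2))
        + ENNReal.ofReal (Real.exp (r * R)))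
      ((((measurable_lyapunov κ xhat).const_mul r).exp.ennreal_ofReal).add_const _)
      (fun y => by
        rw [hlaw (t + 1) ht1]
        by_cases hy : y ∈ K
        · simp only [F, hy, if_true]
          have hsum : 0 ≤ ‖y.2‖ ^ 2 + κ * ‖xhat - y.1‖ ^ 2 := by positivity
          refine lintegral_exp_drift_le hA hC hε hεν hσ hh hhν hhε hy.1 ?_ ?_
          · refine Real.le_sqrt_of_sq_le ?_
            have : 0 ≤ κ * ‖xhat - y.1‖ ^ 2 := by positivity
            linarith
          · rw [lyapunov, Real.sq_sqrt hsum]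
            linarith [hy.2]
        · simp [F, hy])
    have hle : ∫⁻ ω, ENNReal.ofReal (Real.exp (r *
        lyapunov κ xhat (x (t + 1 + 1) ω) (lam (t + 1 + 1) ω))) ∂μ
        ≤ ∫⁻ ω, F ((x (t + 1) ω, lam (t + 1) ω), ξ (t + 1) ω) ∂μ := by
      refine lintegral_mono_ae ?_
      filter_upwards [hgood, hdrift] with ω hg hd
      have hmem : (x (t + 1) ω, lam (t + 1) ω) ∈ K := hg _ hm
      simp only [F, hmem, if_true]
      refine ENNReal.ofReal_le_ofReal (Real.exp_le_exp.2 (mul_le_mul_of_nonneg_left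
        (Real.sqrt_le_sqrt ?_) hr0.le))
      rw [lyapunov, Real.sq_sqrt (by positivity)]
      exact hd _ hm'
    refine (hle.trans key).trans ?_
    rw [lintegral_add_right _ measurable_const, lintegral_const, measure_univ, mul_one]
    refine (add_le_add_left (ih (by omega)) _).trans_eq ?_
    push_cast
    ring

/-- Tail bound for the multipliers, uniform over the first `T` iterations. -/
lemma measure_exists_norm_multiplier_gt_le (hξ : ∀ t, 1 ≤ t → Measurable (ξ t))
    (hlaw : ∀ t, 1 ≤ t → μ.map (ξ t) = P) (hind : iIndepFun (fun k : ℕ => ξ (k + 1)) μ)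
    {h : Vec q → Vec p} {A C ε ν σ κ : ℝ} {xhat : Vec n} (hA : σ * ν ^ 2 / 2 ≤ A) (hC : 0 ≤ C)
    (hκ : 0 ≤ κ)
    (hε : 0 < ε) (hεν : ε ≤ ν) (hσ : 0 < σ) (hh : Measurable h) (hhν : ∀ᵐ z ∂P, ‖h z‖ ≤ ν)
    (hhε : ∀ i, ∫ z, h z i ∂P ≤ -ε)
    {T : ℕ} {x : ℕ → Ω → Vec n} {lam : ℕ → Ω → Vec p}
    (hx : ∀ t ∈ Finset.Icc 1 (T + 1), Measurable[history ξ t] (x t))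
    (hlam : ∀ t ∈ Finset.Icc 1 (T + 1), Measurable[history ξ t] (lam t))
    (hstart : ∀ᵐ ω ∂μ, lam 1 ω = 0)
    (hgood : ∀ᵐ ω ∂μ, ∀ t ∈ Finset.Icc 1 (T + 1),
      (∀ i, 0 ≤ lam t ω i) ∧ κ * ‖xhat - x t ω‖ ^ 2 ≤ C)
    (hdrift : ∀ᵐ ω ∂μ, ∀ t ∈ Finset.Icc 1 T,
      ‖lam (t + 1) ω‖ ^ 2 + κ * ‖xhat - x (t + 1) ω‖ ^ 2
        ≤ ‖lam t ω‖ ^ 2 + κ * ‖xhat - x t ω‖ ^ 2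
          + 2 * σ * (A + ⟪lam t ω, h (ξ t ω)⟫ + ε / 2 * ‖lam t ω‖))
    {φ η : ℝ} (hφ : 4 * A / ε + 2 * √C + 2 * σ * ν
      + 4 * σ * ν ^ 2 / ε * (η + 2 * Real.log (T + 1)) ≤ φ) :
    μ.real (⋃ t ∈ Finset.Icc 1 T, {ω | φ < ‖lam t ω‖}) ≤ Real.exp (-η) := by
  have hν : 0 < ν := hε.trans_le hεν
  set r := ε / (4 * σ * ν ^ 2) with hr
  have hr0 : 0 < r := by positivity
  set R := 4 * A / ε + 2 * √C + 2 * σ * ν with hR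
  have hT1 : (0 : ℝ) < T + 1 := by positivity
  -- One factor `T + 1` pays for the linear growth of the moment, the other for the union over `t`;
  -- hence `2 log(T+1)` in the threshold.
  have hexp : Real.exp (r * R) / Real.exp (r * φ) ≤ Real.exp (-η) / (T + 1) ^ 2 := by
    have h1 : r * (4 * σ * ν ^ 2 / ε) = 1 := by rw [hr]; field_simp
    have h2 := mul_le_mul_of_nonneg_left hφ hr0.le
    rw [mul_add, ← mul_assoc, h1, one_mul] at h2
    have h3 : ((T : ℝ) + 1) ^ 2 = Real.exp (2 * Real.log (T + 1)) := by
      rw [two_mul, Real.exp_add, Real.exp_log hT1]; ring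
    rw [h3, ← Real.exp_sub, ← Real.exp_sub]
    exact Real.exp_le_exp.2 (by linarith)
  have hone : ∀ t ∈ Finset.Icc 1 T, μ.real {ω | φ < ‖lam t ω‖} ≤ Real.exp (-η) / (T + 1) := by
    intro t ht
    obtain ⟨ht1, htT⟩ := Finset.mem_Icc.1 ht
    obtain ⟨k, rfl⟩ : ∃ k, t = k + 1 := ⟨t - 1, by omega⟩
    have hm : k + 1 ∈ Finset.Icc 1 (T + 1) := Finset.mem_Icc.2 ⟨ht1, by omega⟩
    have hE := lintegral_exp_lyapunov_le hξ hlaw hind hA hC hκ hε hεν hσ hh hhν hhε hx hlam hstart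
      hgood hdrift k (by omega)
    rw [← hr, ← hR] at hE
    have hY : Measurable fun ω => (x (k + 1) ω, lam (k + 1) ω) :=
      ((hx _ hm).prodMk (hlam _ hm)).mono (history_le hξ _) le_rfl
    have hM := mul_meas_ge_le_lintegral₀ (μ := μ)
      ((((measurable_lyapunov κ xhat).comp hY).const_mul r).exp.ennreal_ofReal.aemeasurable)
      (ENNReal.ofReal (Real.exp (r * φ)))
    have hsub : {ω | φ < ‖lam (k + 1) ω‖} ⊆ {ω | ENNReal.ofReal (Real.exp (r * φ)) ≤
        ENNReal.ofReal (Real.exp (r * lyapunov κ xhat (x (k + 1) ω) (lam (k + 1) ω)))} := by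
      intro ω hω
      refine ENNReal.ofReal_le_ofReal (Real.exp_le_exp.2 (mul_le_mul_of_nonneg_left
        (le_trans (le_of_lt hω) (Real.le_sqrt_of_sq_le ?_)) hr0.le))
      have : 0 ≤ κ * ‖xhat - x (k + 1) ω‖ ^ 2 := by positivity
      linarith
    have hpos : ENNReal.ofReal (Real.exp (r * φ)) ≠ 0 := by simp [Real.exp_pos]
    have hfin : μ {ω | φ < ‖lam (k + 1) ω‖} ≤ ENNReal.ofReal (Real.exp (-η) / (T + 1)) := by
      refine (measure_mono hsub).trans
        (((ENNReal.le_div_iff_mul_le (Or.inl hpos) (Or.inl ENNReal.ofReal_ne_top)).2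
          ((mul_comm _ _).trans_le (hM.trans hE))).trans ?_)
      have hk : (k : ℝ≥0∞) + 1 = ENNReal.ofReal ((k : ℝ) + 1) := by
        rw [ENNReal.ofReal_add (by positivity) zero_le_one]; simp
      rw [hk, ← ENNReal.ofReal_mul (by positivity), ← ENNReal.ofReal_div_of_pos (Real.exp_pos _)]
      refine ENNReal.ofReal_le_ofReal ?_
      have hkT : (k : ℝ) + 1 ≤ T + 1 := by
        have : (k : ℝ) ≤ T := by exact_mod_cast (by omega : k ≤ T)
        linarith
      calc ((k : ℝ) + 1) * Real.exp (r * R) / Real.exp (r * φ)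
          = (k + 1) * (Real.exp (r * R) / Real.exp (r * φ)) := by ring
        _ ≤ (T + 1) * (Real.exp (-η) / (T + 1) ^ 2) := by gcongr
        _ = Real.exp (-η) / (T + 1) := by field_simp
    exact ENNReal.toReal_le_of_le_ofReal (by positivity) hfin
  calc μ.real (⋃ t ∈ Finset.Icc 1 T, {ω | φ < ‖lam t ω‖})
      ≤ ∑ t ∈ Finset.Icc 1 T, μ.real {ω | φ < ‖lam t ω‖} := measureReal_biUnion_finset_le _ _
    _ ≤ ∑ _t ∈ Finset.Icc 1 T, Real.exp (-η) / (T + 1) := Finset.sum_le_sum hone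
    _ = T / (T + 1) * Real.exp (-η) := by simp; ring
    _ ≤ Real.exp (-η) := mul_le_of_le_one_left (Real.exp_pos _).le
        ((div_le_one hT1).2 (by linarith))

end MultiplierTail

/-! ### Consequences along a run of the algorithm -/

section Run

variable {n p q : ℕ}

lemma AdmissibleMatrices.inner_comm {c : Constants p} {T : ℕ}
    {S : ℕ → Fin p → Vec n →L[ℝ] Vec n} (hS : AdmissibleMatrices c T S) {t : ℕ}
    (ht : t ∈ Finset.Icc 1 T) (i : Fin p) (u v : Vec n) : ⟪S t i u, v⟫ = ⟪S t i v, u⟫ := by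
  rw [real_inner_comm]
  exact ((hS.symmetric t ht i).isSymmetric v u).symm

lemma AdmissibleMatrices.inner_self_le {c : Constants p} {T : ℕ}
    {S : ℕ → Fin p → Vec n →L[ℝ] Vec n} (hS : AdmissibleMatrices c T S) {t : ℕ}
    (ht : t ∈ Finset.Icc 1 T) (i : Fin p) (v : Vec n) : ⟪S t i v, v⟫ ≤ -(c.L i * ‖v‖ ^ 2) := by
  have h := (ContinuousLinearMap.le_def _ _).1 (hS.le_neg t ht i)
  have h2 := h.inner_nonneg_left v
  simp only [sub_apply, neg_apply,
    smul_apply, ContinuousLinearMap.id_apply, inner_sub_left, inner_neg_left,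
    inner_smul_left, RCLike.conj_to_real, real_inner_self_eq_norm_sq] at h2
  linarith

lemma AdmissibleMatrices.le_inner_self {c : Constants p} {T : ℕ}
    {S : ℕ → Fin p → Vec n →L[ℝ] Vec n} (hS : AdmissibleMatrices c T S) {t : ℕ}
    (ht : t ∈ Finset.Icc 1 T) (i : Fin p) (v : Vec n) : -(c.κS * ‖v‖ ^ 2) ≤ ⟪S t i v, v⟫ := by
  have h1 := neg_le_of_abs_le (abs_real_inner_le_norm (S t i v) v)
  have h2 := (S t i).le_of_opNorm_le (hS.norm_le t ht i) v
  nlinarith [mul_le_mul_of_nonneg_right h2 (norm_nonneg v)]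

variable {Q : Problem n p q} {σ α τ : ℝ} {T : ℕ} {z : ℕ → Vec q}
  {S : ℕ → Fin p → Vec n →L[ℝ] Vec n} {x : ℕ → Vec n} {lam : ℕ → Vec p}

lemma IsPMQSoptRun.mem (h : IsPMQSoptRun Q σ α τ T z S x lam) {t : ℕ}
    (ht : t ∈ Finset.Icc 1 (T + 1)) : x t ∈ Q.X₀ := by
  obtain ⟨h1, h2⟩ := Finset.mem_Icc.1 ht
  rcases h1.eq_or_lt with rfl | h1
  · exact h.start_mem
  · obtain ⟨k, rfl⟩ : ∃ k, t = k + 1 := ⟨t - 1, by omega⟩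
    exact h.step_mem k (Finset.mem_Icc.2 ⟨by omega, by omega⟩)

lemma IsPMQSoptRun.multiplier_nonneg (h : IsPMQSoptRun Q σ α τ T z S x lam) {t : ℕ}
    (ht : t ∈ Finset.Icc 1 (T + 1)) (i : Fin p) : 0 ≤ lam t i := by
  obtain ⟨h1, h2⟩ := Finset.mem_Icc.1 ht
  rcases h1.eq_or_lt with rfl | h1
  · simp [h.start_multiplier]
  · obtain ⟨k, rfl⟩ : ∃ k, t = k + 1 := ⟨t - 1, by omega⟩
    rw [h.step_multiplier k (Finset.mem_Icc.2 ⟨by omega, by omega⟩) i]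
    exact le_max_right _ _

lemma IsPMQSoptRun.sum_complementarity_le (h : IsPMQSoptRun Q σ α τ T z S x lam)
    {c : Constants p} (hQ : Q.Standing) (hreg : Q.Regular c) (hS : AdmissibleMatrices c T S)
    (hσ : 0 < σ) (hα : 0 < α) (hτ : 0 ≤ τ) (hz : ∀ t ∈ Finset.Icc 1 T, z t ∈ Q.Ξ) :
    -∑ t ∈ Finset.Icc 1 T, ⟪lam t, Q.G (x t) (z t)⟫
      ≤ T * (σ * c.νg ^ 2 / 2 + c.κf ^ 2 / (2 * α)) := by
  -- The term `-‖λ^{k+1}‖²/(2σ)` is kept so that the induction telescopes; it is dropped at the end.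
  have key : ∀ k ≤ T, -∑ t ∈ Finset.Ico 1 (k + 1), ⟪lam t, Q.G (x t) (z t)⟫
      ≤ k * (σ * c.νg ^ 2 / 2 + c.κf ^ 2 / (2 * α)) - ‖lam (k + 1)‖ ^ 2 / (2 * σ) := by
    intro k hk
    induction k with
    | zero => simp [h.start_multiplier]
    | succ k ih =>
      have hm : k + 1 ∈ Finset.Icc 1 T := Finset.mem_Icc.2 ⟨by omega, hk⟩
      have hm' : k + 1 ∈ Finset.Icc 1 (T + 1) := Finset.mem_Icc.2 ⟨by omega, by omega⟩
      have h1 := complementarity_step hQ hreg hσ hα hτ (hS.inner_self_le hm) (hz _ hm)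
        (h.mem hm') (h.multiplier_nonneg hm') (h.step_min _ hm) (h.step_multiplier _ hm)
      have h2 := ih (by omega)
      rw [Finset.sum_Ico_succ_top (by omega), neg_add]
      rw [sub_div] at h1
      push_cast
      linarith
  have h1 := key T le_rfl
  have h2 : 0 ≤ ‖lam (T + 1)‖ ^ 2 / (2 * σ) := by positivity
  rw [show Finset.Icc 1 T = Finset.Ico 1 (T + 1) by ext; simp]
  linarith

end Run

/-! ### Comparison of the constants -/

section Bounds

variable {n p q : ℕ} {Q : Problem n p q} {c : Constants p}

lemma Problem.Regular.γ₂_pos (h : Q.Regular c) : 0 < c.γ₂ := by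
  have h1 := h.D₀_pos
  have h2 := h.νg_pos
  have h3 := h.κg_pos
  have h4 := h.κS_pos
  unfold Constants.γ₂
  positivity

lemma Problem.Regular.one_lt_β (h : Q.Regular c) : 1 < c.β := by
  have h0 := h.γ₂_pos
  have h1 : 0 ≤ ∑ j, c.γ₂ * c.L j :=
    Finset.sum_nonneg fun j _ => (mul_pos h0 (h.L_pos j)).le
  have h2 := h.L₀_pos
  unfold Constants.β
  linarith

lemma Problem.Regular.νg_le_γ₁ (h : Q.Regular c) : c.νg ≤ c.γ₁ := by
  have h1 := h.D₀_pos
  have h3 := h.κg_pos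
  have h4 := h.κS_pos
  unfold Constants.γ₁
  have : 0 ≤ √(p : ℝ) * (c.κg * c.D₀ + 1 / 2 * c.κS * c.D₀ ^ 2) := by positivity
  linarith

lemma Problem.Regular.ε₀_le_νg (h : Q.Regular c) (hQ : Q.Standing) (hp : 0 < p) :
    c.ε₀ ≤ c.νg := by
  have := hQ.isProbabilityMeasure
  obtain ⟨xhat, hx, hs⟩ := h.slater
  have h1 : ‖∫ z, Q.G xhat z ⟨0, hp⟩ ∂Q.P‖ ≤ c.νg * Q.P.real Set.univ := by
    refine norm_integral_le_of_norm_le_const ?_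
    filter_upwards [hQ.supported] with z hz
    exact (PiLp.norm_apply_le (Q.G xhat z) _).trans (h.norm_G_le _ (hQ.subset_domain hx) z hz)
  rw [probReal_univ, mul_one, Real.norm_eq_abs] at h1
  have h2 : ∫ z, Q.G xhat z ⟨0, hp⟩ ∂Q.P ≤ -c.ε₀ := hs ⟨0, hp⟩
  linarith [neg_le_of_abs_le h1]

lemma rpow_neg_three_quarters {T : ℝ} (hT : 0 ≤ T) :
    T ^ (-(3 / 4) : ℝ) = (T ^ (-(1 / 4) : ℝ)) ^ 3 := by
  rw [← Real.rpow_natCast, ← Real.rpow_mul hT]; norm_num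

/-- The level `φ̂(T,η)` dominates the threshold of the multiplier tail bound. -/
lemma Problem.Regular.threshold_le_phiHat (h : Q.Regular c) (hε : c.ε₀ ≤ c.νg) {T : ℕ}
    (hT : 1 ≤ T) {η : ℝ} (hη : 0 ≤ η) {σ α τ : ℝ} (hσ : σ = (T : ℝ) ^ (-(3 / 4) : ℝ))
    (hα : α = c.β * (T : ℝ) ^ (1 / 4 : ℝ)) (hτ : τ = (T : ℝ) ^ (1 / 2 : ℝ)) :
    4 * (c.κf * c.D₀ + σ * c.γ₁ ^ 2 / 2) / c.ε₀ + 2 * √(σ * (α + τ) * c.D₀ ^ 2) + 2 * σ * c.νg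
      + 4 * σ * c.νg ^ 2 / c.ε₀ * (η + 2 * Real.log (T + 1)) ≤ c.phiHat T η := by
  have hT0 : (0 : ℝ) < T := by exact_mod_cast hT
  have hT1 : (1 : ℝ) ≤ T := by exact_mod_cast hT
  -- Everything becomes polynomial in `w = T^{-1/4}`: `σ = w³` and `σ(α+τ) = w + βw²`.
  set w := (T : ℝ) ^ (-(1 / 4) : ℝ) with hw
  have hw0 : 0 < w := Real.rpow_pos_of_pos hT0 _
  have hw1 : w ≤ 1 := Real.rpow_le_one_of_one_le_of_nonpos hT1 (by norm_num)
  have hσw : σ = w ^ 3 := by rw [hσ, rpow_neg_three_quarters hT0.le]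
  have hκ : σ * (α + τ) = w * (1 + c.β * w) := by
    have e1 : (T : ℝ) ^ (-(3 / 4) : ℝ) * (T : ℝ) ^ (1 / 4 : ℝ) = w ^ 2 := by
      rw [hw, ← Real.rpow_natCast, ← Real.rpow_mul hT0.le, ← Real.rpow_add hT0]; norm_num
    have e2 : (T : ℝ) ^ (-(3 / 4) : ℝ) * (T : ℝ) ^ (1 / 2 : ℝ) = w := by
      rw [hw, ← Real.rpow_add hT0]; norm_num
    rw [hσ, hα, hτ, mul_add, e2, mul_left_comm, e1]; ring
  have hε0 := h.ε₀_pos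
  have hν0 := h.νg_pos
  have hνγ := h.νg_le_γ₁
  have hβ := h.one_lt_β
  have hD := h.D₀_pos
  have hγ0 : 0 < c.γ₁ := hν0.trans_le hνγ
  set g := c.γ₁ ^ 2 / c.ε₀ with hg
  have hgγ : c.γ₁ ≤ g := by
    rw [hg, le_div_iff₀ hε0]; nlinarith
  have hlog : 0 ≤ Real.log ((T : ℝ) + 1) := Real.log_nonneg (by linarith)
  have hℓ : 1 ≤ Real.log (128 * c.γ₁ ^ 2 / c.ε₀ ^ 2) := by
    rw [Real.le_log_iff_exp_le (by positivity), le_div_iff₀ (by positivity)]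
    have h1 : Real.exp 1 ≤ 128 := Real.exp_one_lt_d9.le.trans (by norm_num)
    have h2 : c.ε₀ ^ 2 ≤ c.γ₁ ^ 2 := pow_le_pow_left₀ hε0.le (hε.trans hνγ) 2
    exact mul_le_mul h1 h2 (by positivity) (by norm_num)
  have hw3 : w ^ 3 ≤ w := by
    simpa using pow_le_pow_of_le_one hw0.le hw1 (by norm_num : 1 ≤ 3)
  have hw30 : 0 < w ^ 3 := by positivity
  -- Arithmetic–geometric mean with `κ₁ε₀ = 2D₀²`. It yields the `κ₁` and `κ₁β` terms of `φ̂`; the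
  -- remainder `ε₀w/2` is absorbed by `κ₄`.
  have hsqrt : 2 * √(σ * (α + τ) * c.D₀ ^ 2) ≤ c.κ₁ * (1 + c.β * w) + c.ε₀ * w / 2 := by
    have hk : 0 ≤ c.κ₁ := by unfold Constants.κ₁; positivity
    have h1 : √(σ * (α + τ) * c.D₀ ^ 2) ≤ (c.κ₁ * (1 + c.β * w) + c.ε₀ * w / 2) / 2 := by
      refine Real.sqrt_le_iff.2 ⟨by positivity, ?_⟩
      have e : c.κ₁ * c.ε₀ = 2 * c.D₀ ^ 2 := by unfold Constants.κ₁; field_simp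
      have e2 : c.κ₁ * (1 + c.β * w) * (c.ε₀ * w) = 2 * (w * (1 + c.β * w) * c.D₀ ^ 2) := by
        linear_combination (1 + c.β * w) * w * e
      rw [hκ]
      nlinarith [sq_nonneg (c.κ₁ * (1 + c.β * w) - c.ε₀ * w / 2)]
    linarith
  have hA : 4 * (c.κf * c.D₀ + σ * c.γ₁ ^ 2 / 2) / c.ε₀ = c.κ₀ + 2 * w ^ 3 * g := by
    rw [hσw, hg, Constants.κ₀]; field_simp; ring
  have hE : 4 * σ * c.νg ^ 2 / c.ε₀ * (η + 2 * Real.log (T + 1))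
      ≤ 8 * (w * g) * (η + Real.log (T + 1)) := by
    have h1 : 4 * σ * c.νg ^ 2 / c.ε₀ ≤ 4 * (w * g) := by
      have : c.νg ^ 2 / c.ε₀ ≤ g := by rw [hg]; gcongr
      calc 4 * σ * c.νg ^ 2 / c.ε₀ = 4 * (w ^ 3 * (c.νg ^ 2 / c.ε₀)) := by rw [hσw]; ring
        _ ≤ 4 * (w * g) := by gcongr
    have h2 : 0 ≤ w * g := by positivity
    calc _ ≤ 4 * (w * g) * (η + 2 * Real.log (T + 1)) := by gcongr
      _ ≤ _ := by nlinarith [mul_nonneg h2 hη]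
  have hJ : 2 * σ * c.νg ≤ 2 * (w * c.γ₁) := by
    rw [hσw]
    have := mul_le_mul hw3 hνγ hν0.le hw0.le
    linarith
  have hκ3 : -(w * g) ≤ c.κ₃ * w ^ 3 := by
    have h1 : -c.γ₁ ≤ c.κ₃ := by
      unfold Constants.κ₃
      have : 0 ≤ 2 * c.νg ^ 2 / c.ε₀ := by positivity
      linarith
    have h2 := mul_le_mul_of_nonneg_right h1 hw30.le
    have h3 := mul_le_mul hw3 hgγ hγ0.le hw0.le
    linarith
  -- The logarithm in `κ₄` is at least 1, which leaves `16wg` to cover the `σγ₁²` term, half of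
  -- `ε₀w/2` and the possibly negative `κ₃`.
  have hκ4 : 2 * (w * c.γ₁) + c.ε₀ * w / 4 + 16 * (w * g) ≤ c.κ₄ * w := by
    have h1 : 16 * g ≤ 16 * c.γ₁ ^ 2 / c.ε₀ * Real.log (128 * c.γ₁ ^ 2 / c.ε₀ ^ 2) := by
      have e : 16 * c.γ₁ ^ 2 / c.ε₀ = 16 * g := by rw [hg]; ring
      rw [e]
      exact le_mul_of_one_le_right (by positivity) hℓ
    have h2 := mul_le_mul_of_nonneg_right h1 hw0.le
    unfold Constants.κ₄
    linarith
  have hβE : 8 * (w * g) * (η + Real.log (T + 1))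
      ≤ 16 * c.β * g * (η + Real.log (T + 1)) * w := by
    have h2 : 0 ≤ (w * g) * (η + Real.log (T + 1)) := by positivity
    have := mul_le_mul_of_nonneg_right hβ.le h2
    linarith
  have hεw : c.ε₀ * w ≤ w * g := by
    rw [mul_comm]; exact mul_le_mul_of_nonneg_left ((hε.trans hνγ).trans hgγ) hw0.le
  have hw3g : w ^ 3 * g ≤ w * g := by gcongr
  have hwg : 0 ≤ w * g := by positivity
  rw [Constants.phiHat, rpow_neg_three_quarters hT0.le, ← hw, ← hg, hA]
  linarith

end Bounds

end PMQS

/-! ### Assembly of the deterministic and probabilistic bounds -/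

theorem mainTheorem9
    {n p q : ℕ} (Q : PMQS.Problem n p q) (c : PMQS.Constants p)
    (hQ : Q.Standing) (hreg : Q.Regular c)
    -- the light-tail assumption
    (ρc : ℝ) (hC : Q.LightTail ρc)
    -- the i.i.d. sample
    {Ω : Type*} [MeasurableSpace Ω] (μ : Measure Ω) [IsProbabilityMeasure μ]
    (ξ : ℕ → Ω → PMQS.Vec q)
    (hξ_meas : ∀ t, 1 ≤ t → Measurable (ξ t))
    (hξ_law : ∀ t, 1 ≤ t → μ.map (ξ t) = Q.P)
    (hξ_indep : iIndepFun (fun k : ℕ => ξ (k + 1)) μ)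
    -- the number of iterations
    (T : ℕ)
    (hT : max (c.β ^ 2)
      (max (c.β⁻¹ * p * (c.κg + c.κS * c.D₀ / 2) ^ 2) ((c.κS * c.γ₂) ^ 4)) < (T : ℝ))
    (hκε : √(p : ℝ) * c.κS * c.D₀ ^ 2 ≤ c.ε₀)
    -- the random sequences generated by the algorithm
    (S : ℕ → Fin p → Ω → PMQS.Vec n →L[ℝ] PMQS.Vec n)
    (x : ℕ → Ω → PMQS.Vec n) (lam : ℕ → Ω → PMQS.Vec p)
    (hx_hist : ∀ t ∈ Finset.Icc 1 (T + 1), Measurable[PMQS.history ξ t] (x t))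
    (hlam_hist : ∀ t ∈ Finset.Icc 1 (T + 1), Measurable[PMQS.history ξ t] (lam t))
    (hS : ∀ᵐ ω ∂μ, PMQS.AdmissibleMatrices c T (fun t i => S t i ω))
    (hrun : ∀ᵐ ω ∂μ, PMQS.IsPMQSoptRun Q
      ((T : ℝ) ^ (-(3 / 4) : ℝ)) (c.β * (T : ℝ) ^ (1 / 4 : ℝ)) ((T : ℝ) ^ (1 / 2 : ℝ)) T
      (fun t => ξ t ω) (fun t i => S t i ω) (fun t => x t ω) (fun t => lam t ω))
    (η : ℝ) (hη : 1 < η) :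
    1 - Real.exp (-η) - 2 * Real.exp (-η ^ 2 / 3) ≤
      μ.real {ω | -(∑ t ∈ Finset.Icc 1 T, inner ℝ (lam t ω) (Q.g (x t ω))) ≤
        c.piCm ρc T η} := by
  classical
  have hT0 : (0 : ℝ) < T := (sq_nonneg _).trans_lt ((le_max_left _ _).trans_lt hT)
  have hTn : 0 < T := by exact_mod_cast hT0
  have hβ := hreg.one_lt_β
  set σ := (T : ℝ) ^ (-(3 / 4) : ℝ) with hσ
  set α := c.β * (T : ℝ) ^ (1 / 4 : ℝ) with hα
  set τ := (T : ℝ) ^ (1 / 2 : ℝ) with hτ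
  have hσ0 : 0 < σ := Real.rpow_pos_of_pos hT0 _
  have hα0 : 0 < α := mul_pos (by linarith) (Real.rpow_pos_of_pos hT0 _)
  have hτ0 : 0 < τ := Real.rpow_pos_of_pos hT0 _
  -- `Tσ = T^{1/4}` and `T/α = β⁻¹T^{3/4}`.
  have hdet : (T : ℝ) * (σ * c.νg ^ 2 / 2 + c.κf ^ 2 / (2 * α))
      = c.νg ^ 2 / 2 * (T : ℝ) ^ (1 / 4 : ℝ) + c.κf ^ 2 / 2 * c.β⁻¹ * (T : ℝ) ^ (3 / 4 : ℝ) := by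
    have e1 : (T : ℝ) * σ = (T : ℝ) ^ (1 / 4 : ℝ) := by
      rw [hσ]
      nth_rw 1 [← Real.rpow_one (T : ℝ)]
      rw [← Real.rpow_add hT0]; norm_num
    have e2 : (T : ℝ) = (T : ℝ) ^ (1 / 4 : ℝ) * (T : ℝ) ^ (3 / 4 : ℝ) := by
      rw [← Real.rpow_add hT0]; norm_num
    have e3 : (T : ℝ) * (c.κf ^ 2 / (2 * α)) = c.κf ^ 2 / 2 * c.β⁻¹ * (T : ℝ) ^ (3 / 4 : ℝ) := by
      have h4 : (T : ℝ) ^ (1 / 4 : ℝ) ≠ 0 := (Real.rpow_pos_of_pos hT0 _).ne'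
      have hβ0 : c.β ≠ 0 := by linarith
      rw [hα]
      nth_rw 1 [e2]
      field_simp
    rw [mul_add, e3, ← e1]; ring
  -- Without constraints the sum vanishes and the event is certain; `ε₀ ≤ ν_g` needs at least one
  -- constraint.
  rcases Nat.eq_zero_or_pos p with hp | hp
  · subst hp
    have hpi : 0 ≤ c.piCm ρc T η := by
      have : 0 < c.β := by linarith
      unfold PMQS.Constants.piCm
      simp only [Nat.cast_zero, zero_mul, zero_add]
      positivity
    have huniv : {ω | -(∑ t ∈ Finset.Icc 1 T, inner ℝ (lam t ω) (Q.g (x t ω))) ≤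
        c.piCm ρc T η} = Set.univ := Set.eq_univ_of_forall fun ω => by
      simpa [PMQS.inner_eq_sum] using hpi
    rw [huniv, probReal_univ]
    linarith [Real.exp_pos (-η), Real.exp_pos (-η ^ 2 / 3)]
  have hε := hreg.ε₀_le_νg hQ hp
  have hε0 := hreg.ε₀_pos
  have hν0 := hreg.νg_pos
  set φ := c.phiHat T η with hφ
  obtain ⟨xhat, hxhat, hslater⟩ := hreg.slater
  obtain ⟨H, hH, hHG⟩ := hQ.exists_measurable_version
  obtain ⟨D, hD, hDG, hDP⟩ := hC.exists_centered_version hQ hreg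
  have hthr := hreg.threshold_le_phiHat hε hTn (by linarith : 0 ≤ η) hσ hα hτ
  have hA : σ * c.νg ^ 2 / 2 ≤ c.κf * c.D₀ + σ * c.γ₁ ^ 2 / 2 := by
    have h1 : c.νg ^ 2 ≤ c.γ₁ ^ 2 := pow_le_pow_left₀ hν0.le hreg.νg_le_γ₁ 2
    have h2 := mul_le_mul_of_nonneg_left h1 hσ0.le
    have h3 := mul_pos hreg.κf_pos hreg.D₀_pos
    linarith
  have hκ : 0 ≤ σ * (α + τ) := by positivity
  have hφ0 : 0 < φ := by
    refine lt_of_lt_of_le ?_ hthr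
    have h1 : 0 < c.κf * c.D₀ + σ * c.γ₁ ^ 2 / 2 := lt_of_lt_of_le (by positivity) hA
    have h2 : 0 ≤ Real.log ((T : ℝ) + 1) := Real.log_nonneg (by linarith)
    positivity
  have hξH : ∀ᵐ ω ∂μ, ∀ t ∈ Finset.Icc 1 T, ξ t ω ∈ Q.Ξ ∧
      (∀ y ∈ Q.X₀, H y (ξ t ω) = Q.G y (ξ t ω)) ∧
      ∀ y ∈ Q.X₀, D y (ξ t ω) = Q.G y (ξ t ω) - Q.g y := by
    refine (ae_ball_iff (Finset.Icc 1 T).countable_toSet).2 fun t ht => ?_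
    have ht1 := (Finset.mem_Icc.1 ht).1
    have h1 := hHG.and hDG
    rw [← hξ_law t ht1] at h1
    filter_upwards [ae_of_ae_map (hξ_meas t ht1).aemeasurable h1] with ω hω
    exact ⟨hω.1.1, hω.1.2, hω.2⟩
  have hstart : ∀ᵐ ω ∂μ, lam 1 ω = 0 := by
    filter_upwards [hrun] with ω hω using hω.start_multiplier
  have hgood : ∀ᵐ ω ∂μ, ∀ t ∈ Finset.Icc 1 (T + 1),
      (∀ i, 0 ≤ lam t ω i) ∧ σ * (α + τ) * ‖xhat - x t ω‖ ^ 2 ≤ σ * (α + τ) * c.D₀ ^ 2 := by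
    filter_upwards [hrun] with ω hω t ht
    refine ⟨hω.multiplier_nonneg ht, mul_le_mul_of_nonneg_left ?_ hκ⟩
    exact pow_le_pow_left₀ (norm_nonneg _) (hreg.diam_le _ hxhat _ (hω.mem ht)) 2
  have hdrift : ∀ᵐ ω ∂μ, ∀ t ∈ Finset.Icc 1 T,
      ‖lam (t + 1) ω‖ ^ 2 + σ * (α + τ) * ‖xhat - x (t + 1) ω‖ ^ 2
        ≤ ‖lam t ω‖ ^ 2 + σ * (α + τ) * ‖xhat - x t ω‖ ^ 2
          + 2 * σ * (c.κf * c.D₀ + σ * c.γ₁ ^ 2 / 2 + ⟪lam t ω, H xhat (ξ t ω)⟫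
            + c.ε₀ / 2 * ‖lam t ω‖) := by
    filter_upwards [hrun, hS, hξH] with ω hω hSω hξω t ht
    have ht' : t ∈ Finset.Icc 1 (T + 1) := Finset.Icc_subset_Icc_right T.le_succ ht
    rw [(hξω t ht).2.1 xhat hxhat]
    exact PMQS.multiplier_drift hQ hreg hκε hσ0 (by positivity) (hSω.inner_comm ht)
      (hSω.le_inner_self ht) (hSω.inner_self_le ht) (hξω t ht).1 (hω.mem ht')
      (hω.step_mem t ht) hxhat (hω.multiplier_nonneg ht') (hω.step_min t ht)
      (hω.step_multiplier t ht)
  have hHmeas : Measurable (H xhat) := hH.of_uncurry_left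
  have hHν : ∀ᵐ z ∂Q.P, ‖H xhat z‖ ≤ c.νg := by
    filter_upwards [hHG] with z hz
    rw [hz.2 xhat hxhat]
    exact hreg.norm_G_le _ (hQ.subset_domain hxhat) z hz.1
  have hHε : ∀ i, ∫ z, H xhat z i ∂Q.P ≤ -c.ε₀ := fun i => by
    refine le_of_eq_of_le (integral_congr_ae ?_) (hslater i)
    filter_upwards [hHG] with z hz
    rw [hz.2 xhat hxhat]
  have htail := PMQS.measure_exists_norm_multiplier_gt_le hξ_meas hξ_law hξ_indep hA
    (by positivity : 0 ≤ σ * (α + τ) * c.D₀ ^ 2) hκ hε0 hε hσ0 hHmeas hHν hHε hx_hist hlam_hist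
    hstart hgood hdrift hthr
  have hmart := PMQS.measure_truncSum_ge_le hξ_meas hξ_law hξ_indep hD hC.ρc_pos hφ0 hp
    (by linarith : 0 ≤ η) hDP hTn hx_hist hlam_hist
  set B₁ := ⋃ t ∈ Finset.Icc 1 T, {ω | φ < ‖lam t ω‖} with hB₁
  set B₂ := {ω | η * (p * φ * ρc) * √(T : ℝ) < PMQS.truncSum φ D ξ x lam (T + 1) ω} with hB₂
  have hB₁m : MeasurableSet B₁ := by
    refine Finset.measurableSet_biUnion _ fun t ht => ?_
    have hl : Measurable (lam t) := (hlam_hist t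
      (Finset.Icc_subset_Icc_right T.le_succ ht)).mono (PMQS.history_le hξ_meas t) le_rfl
    exact measurableSet_lt measurable_const hl.norm
  have hB₂m : MeasurableSet B₂ := measurableSet_lt measurable_const
    ((PMQS.measurable_truncSum hD hx_hist hlam_hist le_rfl).mono
      (PMQS.history_le hξ_meas _) le_rfl)
  have hsub : ∀ᵐ ω ∂μ, ω ∈ (B₁ ∪ B₂)ᶜ →
      ω ∈ {ω | -(∑ t ∈ Finset.Icc 1 T, inner ℝ (lam t ω) (Q.g (x t ω))) ≤ c.piCm ρc T η} := by
    filter_upwards [hrun, hS, hξH] with ω hω hSω hξω hnot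
    have hn1 : ∀ t ∈ Finset.Icc 1 T, ‖lam t ω‖ ≤ φ := fun t ht => by
      by_contra! hlt
      exact hnot (Or.inl (Set.mem_biUnion ht hlt))
    have hn2 : PMQS.truncSum φ D ξ x lam (T + 1) ω ≤ η * (p * φ * ρc) * √(T : ℝ) := by
      by_contra! hlt
      exact hnot (Or.inr hlt)
    -- Off `B₁` the truncation is inactive, so the truncated sum is the actual noise sum.
    have hsum : PMQS.truncSum φ D ξ x lam (T + 1) ω
        = ∑ t ∈ Finset.Icc 1 T, ⟪lam t ω, Q.G (x t ω) (ξ t ω)⟫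
          - ∑ t ∈ Finset.Icc 1 T, ⟪lam t ω, Q.g (x t ω)⟫ := by
      rw [PMQS.truncSum, show Finset.Ico 1 (T + 1) = Finset.Icc 1 T by ext; simp,
        ← Finset.sum_sub_distrib]
      refine Finset.sum_congr rfl fun t ht => ?_
      have ht' : t ∈ Finset.Icc 1 (T + 1) := Finset.Icc_subset_Icc_right T.le_succ ht
      rw [PMQS.truncate, if_pos (hn1 t ht), (hξω t ht).2.2 _ (hω.mem ht'), inner_sub_right]
    have hdetω := hω.sum_complementarity_le hQ hreg hSω hσ0 hα0 hτ0.le fun t ht => (hξω t ht).1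
    rw [hdet] at hdetω
    rw [hsum, Real.sqrt_eq_rpow] at hn2
    change -(∑ t ∈ Finset.Icc 1 T, ⟪lam t ω, Q.g (x t ω)⟫) ≤ c.piCm ρc T η
    rw [PMQS.Constants.piCm, ← hφ]
    linarith
  have hle : μ.real (B₁ ∪ B₂)ᶜ ≤
      μ.real {ω | -(∑ t ∈ Finset.Icc 1 T, inner ℝ (lam t ω) (Q.g (x t ω))) ≤ c.piCm ρc T η} :=
    ENNReal.toReal_mono (measure_ne_top _ _) (measure_mono_ae hsub)
  rw [probReal_compl_eq_one_sub (hB₁m.union hB₂m)] at hle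
  have hunion := measureReal_union_le (μ := μ) B₁ B₂
  linarith [Real.exp_pos (-η ^ 2 / 3)]
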